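/- **Lemma.** Let $K$ be a field of characteristic $0$, let $G$ be a finite group and let $V$ be a finite-dimensional representation of $G$ over $K$. Assume: (a) there are an integer $m\ge 0$ and a $G$-invariant element $a\in\bigwedge^2V$ such that each of the two graded algebras $R=\bigwedge^\bullet V$ and $R=(\bigwedge^\bullet V)^G$ is concentrated in degrees $0,\dots,2m$ with $R_{2m}\ne0$, and for both of them multiplication by $a^k$ is an isomorphism $R_{m-k}\to R_{m+k}$ for all $k\ge 0$; (b) there are an irreducible $K$-representation $\rho$ of $G$ and an integer $n\ge 0$ with $V\cong\rho^n$ if $\rho\cong\rho^*$, and $V\cong\rho^n\oplus(\rho^*)^n$ if $\rho\not\cong\rho^*$. Let $A$ be the factor of the semisimple algebra $K[G]$ associated to $\{\rho,\rho^*\}$ (the product of the simple factors acting nontrivially on $\rho$ or $\rho^*$), with the involution $\sigma$ induced by $g\mapsto g^{-1}$, and let $F=Z(A)$. Let $\widetilde V=V\oplus V^*$, where $A$ acts on $V^*$ by $(a\eta)(v)=\eta(\sigma(a)v)$, with the bilinear form $b((v,\eta),(v',\eta'))=\eta(v')+\eta'(v)$. Let $\widetilde A=\operatorname{End}_A(\widetilde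 V)$, with the involution $\widetilde\sigma$ adjoint to $b$, and let $\mathfrak s(\widetilde A,\widetilde\sigma)$ be the derived Lie algebra of $\{x\in\widetilde A:\widetilde\sigma(x)=-x\}$ (with the commutator bracket). Grade $\widetilde V$ by putting $V$ in degree $1$ and $V^*$ in degree $-1$, and grade $\operatorname{End}_K(\widetilde V)$ and $\mathfrak s(\widetilde A,\widetilde\sigma)$ accordingly. The degree $\deg(\widetilde A)$ is the integer $d$ such that $\widetilde A$ is free of rank $d^2$ over its centre; this is the usual degree if $\widetilde A$ is simple, and it is $\deg(\widetilde A_1)$ if $\widetilde A=\widetilde A_1\times\widetilde A_2$ is a product of two simple algebras exchanged by $\widetilde\sigma$. The involution $\widetilde\sigma$ is called orthogonal if $\widetilde A$ is simple, $\widetilde\sigma$ is trivial on its centre, and over a splitting field $\widetilde\sigma$ becomes the adjoint involution of a non-degenerate symmetric bilinear form. Then: 1. Unless $\widetilde\sigma$ is orthogonal and $\deg(\widetilde A)=4$, the Lie algebra $\mathfrak s(\widetilde A,\widetilde\sigma)$ is generated by its elements of degrees $2$ and $-2$. 2. If $\widetilde\sigma$ is orthogonal and $\deg(\widetilde A)=4$,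 then the Lie subalgebra of $\mathfrak s(\widetilde A,\widetilde\sigma)$ generated by the elements of degrees $2$ and $-2$ is stable under the action of $F$ on $\operatorname{End}_K(\widetilde V)$ given by $z\cdot x=(\text{action of }z\text{ on }\widetilde V)\circ x$, and it is isomorphic to $\mathfrak{sl}_2(F)$ by an $F$-linear isomorphism of Lie algebras. -/

import Mathlib

open scoped TensorProduct MonoidAlgebra
open Module

attribute [local instance 100] LieRing.ofAssociativeRing

noncomputable section

/-! ### Algebras with involution -/

/-- A `K`-linear involution on an associative `K`-algebra: a `K`-linear anti-automorphism
of order at most two. -/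
structure AlgInvolution (K B : Type*) [CommRing K] [Ring B] [Algebra K B] extends B →ₗ[K] B where
  map_mul_rev' : ∀ x y : B, toFun (x * y) = toFun y * toFun x
  involutive' : ∀ x : B, toFun (toFun x) = x

namespace AlgInvolution

universe u v

variable {K : Type v} {B : Type u} [CommRing K] [Ring B] [Algebra K B]

instance : CoeFun (AlgInvolution K B) (fun _ => B → B) := ⟨fun σ => σ.toLinearMap⟩

theorem map_mul_rev (σ : AlgInvolution K B) (x y : B) : σ (x * y) = σ y * σ x :=
  σ.map_mul_rev' x y

theorem apply_apply (σ : AlgInvolution K B) (x : B) : σ (σ x) = x :=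
  σ.involutive' x

/-- The Lie algebra `Skew(B, σ)` of elements with `σ x = - x`, with the commutator bracket. -/
def skew (σ : AlgInvolution K B) : LieSubalgebra K B where
  carrier := {x | σ x = -x}
  add_mem' := by
    intro x y hx hy
    simp only [Set.mem_ofPred_eq] at *
    rw [map_add, hx, hy]; abel
  zero_mem' := by simp
  smul_mem' := by
    intro c x hx
    simp only [Set.mem_ofPred_eq] at *
    rw [map_smul, hx, smul_neg]
  lie_mem' := by
    intro x y hx hy
    have hx' : σ x = -x := hx
    have hy' : σ y = -y := hy
    change σ ⁅x, y⁆ = -⁅x, y⁆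
    rw [Ring.lie_def, map_sub, map_mul_rev, map_mul_rev, hx', hy']
    simp

/-- The Lie algebra `𝔰(B, σ)`: the derived Lie algebra of `Skew(B, σ)`. -/
abbrev derivedSkew (σ : AlgInvolution K B) : LieIdeal K σ.skew :=
  LieAlgebra.derivedSeries K σ.skew 1

/-- `σ` is of the first kind: it fixes the centre of `B` pointwise. -/
def IsFirstKind (σ : AlgInvolution K B) : Prop :=
  ∀ z ∈ Subring.center B, σ z = z

/-- `σ` is of orthogonal type: `B` is simple (so that its centre `Z` is a field, over which `B` is
central simple), `σ` is of the first kind, and over some splitting field `L` of `B` the involution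
`id ⊗ σ` becomes the adjoint involution `M ↦ g⁻¹ Mᵀ g` of a symmetric non-degenerate bilinear form
(with Gram matrix `g`). -/
def IsOrthogonal (σ : AlgInvolution K B) : Prop :=
  IsSimpleRing B ∧ σ.IsFirstKind ∧
    ∃ (L : Type u) (_ : Field L) (_ : Algebra (Subring.center B) L) (d : ℕ)
      (φ : L ⊗[Subring.center B] B ≃ₐ[L] Matrix (Fin d) (Fin d) L)
      (g : Matrix (Fin d) (Fin d) L),
      IsUnit g.det ∧ g.transpose = g ∧
        ∀ x : B, φ (1 ⊗ₜ σ x) = g⁻¹ * (φ (1 ⊗ₜ x)).transpose * g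

end AlgInvolution

/-- The degree of a finite-dimensional algebra `B` which is simple, or a product of two simple
algebras that are exchanged by an involution. With `Z` the centre of `B`, the `Z`-module `B` is
free of rank `d ^ 2` (also when `B = B₁ × B₂`, in which case `Z = Z₁ × Z₂`, and
`d = deg B₁ = deg B₂`), and the degree is `d`. -/
def algDegree (B : Type*) [Ring B] : ℕ :=
  Nat.sqrt (Module.finrank (Subring.center B) B)

/-! ### The module `V ⊕ V*` over an algebra with involution -/

section Tilde

variable {K : Type*} [Field K] {A : Type*} [Ring A] [Algebra K A] (σ : AlgInvolution K A)
  {V : Type*} [AddCommGroup V] [Module K V]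

/-- The dual of the `A`-module `V` (given by `r`): `(a • η) v = η (σ a • v)`. -/
def dualAction (r : A →ₐ[K] End K V) : A →ₐ[K] End K (Dual K V) :=
  AlgHom.ofLinearMap
    { toFun := fun a => Dual.transpose (R := K) (r (σ a))
      map_add' := fun a b => by simp
      map_smul' := fun c a => by simp }
    (by
      have h1 : σ 1 = 1 := by
        have h := σ.map_mul_rev (σ 1) 1
        rw [mul_one, σ.apply_apply, mul_one] at h
        exact h.symm
      ext η v
      simp [h1, Dual.transpose_apply])
    (fun a b => by
      ext η v
      simp [σ.map_mul_rev, Dual.transpose_apply])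

variable (K V) in
/-- The vector space `Ṽ = V ⊕ V*`. -/
def Tilde : Type _ := V × Dual K V

instance : AddCommGroup (Tilde K V) := inferInstanceAs (AddCommGroup (V × Dual K V))

instance : Module K (Tilde K V) := inferInstanceAs (Module K (V × Dual K V))

instance [FiniteDimensional K V] : FiniteDimensional K (Tilde K V) :=
  inferInstanceAs (FiniteDimensional K (V × Dual K V))

/-- The `A`-module `Ṽ = V ⊕ V*`: `a • (v, η) = (a • v, a • η)`. -/
def tildeAction (r : A →ₐ[K] End K V) : A →ₐ[K] End K (Tilde K V) :=
  AlgHom.ofLinearMap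
    { toFun := fun a => ((r a).prodMap (dualAction σ r a) : V × Dual K V →ₗ[K] V × Dual K V)
      map_add' := fun a b => LinearMap.ext fun x =>
        Prod.ext (by simp; rfl) (by simp; rfl)
      map_smul' := fun c a => LinearMap.ext fun x =>
        Prod.ext (by simp; rfl) (by simp; rfl) }
    (LinearMap.ext fun x => Prod.ext
      (congrArg (fun f : End K V => f x.1) (map_one r))
      (congrArg (fun f : End K (Dual K V) => f x.2) (map_one (dualAction σ r))))
    (fun a b => LinearMap.ext fun x => Prod.ext
      (congrArg (fun f : End K V => f x.1) (map_mul r a b))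
      (congrArg (fun f : End K (Dual K V) => f x.2) (map_mul (dualAction σ r) a b)))

theorem tildeAction_fst (r : A →ₐ[K] End K V) (a : A) (x : Tilde K V) :
    (tildeAction σ r a x).1 = r a x.1 := rfl

theorem tildeAction_snd (r : A →ₐ[K] End K V) (a : A) (x : Tilde K V) :
    (tildeAction σ r a x).2 = x.2 ∘ₗ r (σ a) := rfl

variable (K V) in
/-- The bilinear form `b((v, η), (v', η')) = η(v') + η'(v)` on `Ṽ = V ⊕ V*`. -/
def tildeForm : LinearMap.BilinForm K (Tilde K V) :=
  (LinearMap.mk₂ K (fun x y => x.2 y.1 + y.2 x.1)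
    (fun x x' y => by simp; abel) (fun c x y => by simp [mul_add])
    (fun x y y' => by simp; abel) (fun c x y => by simp [mul_add]) :
      V × Dual K V →ₗ[K] V × Dual K V →ₗ[K] K)

theorem tildeForm_apply (x y : Tilde K V) : tildeForm K V x y = x.2 y.1 + y.2 x.1 := rfl

theorem tildeForm_symm (x y : Tilde K V) : tildeForm K V x y = tildeForm K V y x := by
  rw [tildeForm_apply, tildeForm_apply, add_comm]

variable (K V) in
theorem tildeForm_nondegenerate : (tildeForm K V).Nondegenerate := by
  have key : ∀ x : Tilde K V, (∀ y, tildeForm K V x y = 0) → x = 0 := by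
    rintro ⟨v, η⟩ h
    refine Prod.ext ?_ ?_
    · refine (Module.forall_dual_apply_eq_zero_iff K v).1 fun f => ?_
      have h' : η 0 + f v = 0 := h (0, f)
      simpa using h'
    · refine LinearMap.ext fun w => ?_
      have h' : η w + (0 : Dual K V) v = 0 := h (w, 0)
      have h'' : η w = 0 := by simpa using h'
      exact h''
  exact ⟨key, fun y hy => key y fun x => by rw [tildeForm_symm]; exact hy x⟩

/-- The bilinear form is `A`-equivariant: `b(a x, y) = b(x, σ(a) y)`. -/
theorem tildeForm_action (r : A →ₐ[K] End K V) (a : A) (x y : Tilde K V) :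
    tildeForm K V (tildeAction σ r a x) y = tildeForm K V x (tildeAction σ r (σ a) y) := by
  simp [tildeForm_apply, tildeAction_fst, tildeAction_snd, σ.apply_apply]

/-- The algebra `Ã = End_A(V ⊕ V*)`. -/
def endTilde (r : A →ₐ[K] End K V) : Subalgebra K (End K (Tilde K V)) :=
  Subalgebra.centralizer K (Set.range (tildeAction σ r))

variable [FiniteDimensional K V]

/-- The adjoint of an endomorphism of `Ṽ` with respect to the bilinear form. -/
def tildeAdjoint (f : End K (Tilde K V)) : End K (Tilde K V) :=
  (tildeForm K V).leftAdjointOfNondegenerate (tildeForm_nondegenerate K V) f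

theorem tildeAdjoint_spec (f : End K (Tilde K V)) (x y : Tilde K V) :
    tildeForm K V (tildeAdjoint f x) y = tildeForm K V x (f y) :=
  LinearMap.BilinForm.isAdjointPairLeftAdjointOfNondegenerate _ (tildeForm_nondegenerate K V) f x y

theorem eq_tildeAdjoint (f g : End K (Tilde K V))
    (h : ∀ x y, tildeForm K V (g x) y = tildeForm K V x (f y)) : g = tildeAdjoint f :=
  (LinearMap.BilinForm.isAdjointPair_iff_eq_of_nondegenerate _ (tildeForm_nondegenerate K V) g f).1 h

theorem tildeAdjoint_mul (f g : End K (Tilde K V)) :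
    tildeAdjoint (f * g) = tildeAdjoint g * tildeAdjoint f := by
  symm
  apply eq_tildeAdjoint
  intro x y
  simp [tildeAdjoint_spec]

theorem tildeAdjoint_tildeAdjoint (f : End K (Tilde K V)) :
    tildeAdjoint (tildeAdjoint f) = f := by
  symm
  apply eq_tildeAdjoint
  intro x y
  rw [tildeForm_symm, ← tildeAdjoint_spec, tildeForm_symm]

theorem tildeAdjoint_action (r : A →ₐ[K] End K V) (a : A) :
    tildeAdjoint (tildeAction σ r a) = tildeAction σ r (σ a) := by
  symm
  apply eq_tildeAdjoint
  intro x y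
  rw [tildeForm_action, σ.apply_apply]

theorem tildeAdjoint_mem (r : A →ₐ[K] End K V) {f : End K (Tilde K V)}
    (hf : f ∈ endTilde σ r) : tildeAdjoint f ∈ endTilde σ r := by
  unfold endTilde at *
  rw [Subalgebra.mem_centralizer_iff] at *
  rintro _ ⟨a, rfl⟩
  have h := congrArg tildeAdjoint (hf _ ⟨σ a, rfl⟩)
  rw [tildeAdjoint_mul, tildeAdjoint_mul, tildeAdjoint_action, σ.apply_apply] at h
  exact h.symm

/-- The involution `σ̃` on `Ã = End_A(V ⊕ V*)` that is adjoint to the bilinear form. -/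
def tildeInvolution (r : A →ₐ[K] End K V) : AlgInvolution K (endTilde σ r) where
  toFun f := ⟨tildeAdjoint f.1, tildeAdjoint_mem σ r f.2⟩
  map_add' f g := by
    refine Subtype.ext ?_
    symm
    apply eq_tildeAdjoint
    intro x y
    simp [tildeAdjoint_spec]
  map_smul' c f := by
    refine Subtype.ext ?_
    symm
    apply eq_tildeAdjoint
    intro x y
    simp [tildeAdjoint_spec]
  map_mul_rev' f g := Subtype.ext (tildeAdjoint_mul f.1 g.1)
  involutive' f := Subtype.ext (tildeAdjoint_tildeAdjoint f.1)

end Tilde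

/-! ### The grading -/

section Grading

variable (K V : Type*) [Field K] [AddCommGroup V] [Module K V]

/-- The grading of `Ṽ` with `V` in degree `1` and `V*` in degree `-1`. -/
def tildeGrading (i : ℤ) : Submodule K (Tilde K V) :=
  if i = 1 then LinearMap.range (LinearMap.inl K V (Dual K V))
  else if i = -1 then LinearMap.range (LinearMap.inr K V (Dual K V))
  else ⊥

variable {K V} in
/-- An endomorphism of `Ṽ` is of degree `d` if it maps the degree `i` part to the
degree `i + d` part for all `i`. -/
def EndHasDegree (d : ℤ) (f : End K (Tilde K V)) : Prop :=
  ∀ i : ℤ, ∀ x ∈ tildeGrading K V i, f x ∈ tildeGrading K V (i + d)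

end Grading

/-! ### The factor of the group algebra -/

section Factor

variable {K : Type*} [Field K] {G : Type*} [Group G]
  {W : Type*} [AddCommGroup W] [Module K W]

variable (K G) in
/-- The anti-automorphism `g ↦ g⁻¹` of the group algebra. -/
def groupAlgInv : K[G] →ₐ[K] (K[G])ᵐᵒᵖ :=
  MonoidAlgebra.lift K (K[G])ᵐᵒᵖ G
    { toFun := fun g => MulOpposite.op (MonoidAlgebra.single g⁻¹ 1)
      map_one' := by simp [MonoidAlgebra.one_def]
      map_mul' := fun g h => by
        rw [← MulOpposite.op_mul, MonoidAlgebra.single_mul_single]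
        simp }

theorem groupAlgInv_single (g : G) (c : K) :
    (groupAlgInv K G (MonoidAlgebra.single g c)).unop = MonoidAlgebra.single g⁻¹ c := by
  simp [groupAlgInv]

theorem groupAlgInv_groupAlgInv (x : K[G]) :
    (groupAlgInv K G (groupAlgInv K G x).unop).unop = x := by
  induction x using MonoidAlgebra.induction_linear with
  | zero => simp
  | add x y hx hy => simp only [map_add, MulOpposite.unop_add, hx, hy]
  | single g c => simp [groupAlgInv_single]

theorem dual_asAlgebraHom (ρ : Representation K G W) (x : K[G]) :
    ρ.dual.asAlgebraHom x = Dual.transpose (R := K) (ρ.asAlgebraHom (groupAlgInv K G x).unop) := by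
  induction x using MonoidAlgebra.induction_linear with
  | zero => simp
  | add x y hx hy => simp only [map_add, MulOpposite.unop_add, hx, hy]
  | single g c =>
    rw [groupAlgInv_single]
    ext η v
    simp [Dual.transpose_apply]

/-- The elements of `K[G]` that act as zero on both `ρ` and `ρ*`. -/
def factorIdeal (ρ : Representation K G W) : Ideal K[G] :=
  RingHom.ker (ρ.asAlgebraHom.prod ρ.dual.asAlgebraHom)

instance (ρ : Representation K G W) : (factorIdeal ρ).IsTwoSided := by
  unfold factorIdeal; infer_instance

theorem mem_factorIdeal (ρ : Representation K G W) (x : K[G]) :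
    x ∈ factorIdeal ρ ↔ ρ.asAlgebraHom x = 0 ∧ ρ.dual.asAlgebraHom x = 0 := by
  unfold factorIdeal
  rw [RingHom.mem_ker]
  simp [Prod.ext_iff]

theorem transpose_eq_zero {f : End K W} (h : Dual.transpose (R := K) f = 0) : f = 0 := by
  ext w
  refine (Module.forall_dual_apply_eq_zero_iff K (f w)).1 fun η => ?_
  have := congrArg (fun F => F η w) h
  simpa [Dual.transpose_apply] using this

theorem groupAlgInv_mem_factorIdeal (ρ : Representation K G W) {x : K[G]}
    (hx : x ∈ factorIdeal ρ) : (groupAlgInv K G x).unop ∈ factorIdeal ρ := by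
  rw [mem_factorIdeal] at hx ⊢
  refine ⟨transpose_eq_zero ?_, ?_⟩
  · rw [← dual_asAlgebraHom]; exact hx.2
  · rw [dual_asAlgebraHom, groupAlgInv_groupAlgInv, hx.1]; simp

/-- The factor `A` of the (semisimple) group algebra `K[G]` associated to the class `[ρ] = {ρ, ρ*}`.
It is the product of the simple factors of `K[G]` that act nontrivially on `ρ` or on `ρ*`, and
it is described here as the image of the projection of `K[G]` onto it, that is, as the quotient of
`K[G]` by the product of the other simple factors. -/
abbrev GroupAlgFactor (ρ : Representation K G W) : Type _ := K[G] ⧸ factorIdeal ρ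

/-- The involution of the factor `A` of `K[G]` induced by `g ↦ g⁻¹`, as a map to the opposite
algebra. -/
def factorInvolutionOp (ρ : Representation K G W) :
    GroupAlgFactor ρ →ₐ[K] (GroupAlgFactor ρ)ᵐᵒᵖ :=
  Ideal.Quotient.liftₐ (factorIdeal ρ)
    ((AlgHom.op (Ideal.Quotient.mkₐ K (factorIdeal ρ))).comp (groupAlgInv K G))
    (fun _ hx => MulOpposite.unop_injective
      (Ideal.Quotient.eq_zero_iff_mem.2 (groupAlgInv_mem_factorIdeal ρ hx)))

theorem factorInvolutionOp_mk (ρ : Representation K G W) (x : K[G]) :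
    (factorInvolutionOp ρ (Ideal.Quotient.mk (factorIdeal ρ) x)).unop =
      Ideal.Quotient.mk (factorIdeal ρ) (groupAlgInv K G x).unop := rfl

/-- The involution of the factor `A` of `K[G]` induced by `g ↦ g⁻¹`. -/
def factorInvolution (ρ : Representation K G W) : AlgInvolution K (GroupAlgFactor ρ) where
  toFun x := (factorInvolutionOp ρ x).unop
  map_add' x y := by simp
  map_smul' c x := by simp
  map_mul_rev' x y := by simp
  involutive' x := by
    obtain ⟨x, rfl⟩ := Ideal.Quotient.mk_surjective x
    rw [factorInvolutionOp_mk, factorInvolutionOp_mk, groupAlgInv_groupAlgInv]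

end Factor

/-! ### The setup -/

section Setup

variable {K : Type*} [Field K] {G : Type*} [Group G]
  {V : Type*} [AddCommGroup V] [Module K V] {W : Type*} [AddCommGroup W] [Module K W]

/-- The `n`-th power `ρ ^ n` (direct sum of `n` copies) of a representation. -/
def repPow (ρ : Representation K G W) (n : ℕ) : Representation K G (Fin n → W) where
  toFun g := (ρ g).compLeft (Fin n)
  map_one' := by ext; simp
  map_mul' g h := by ext; simp

/-- The graded subring of `G`-invariants of `⋀ V`, in degree `k`. -/
def extInvariants (π : Representation K G V) (k : ℕ) : Submodule K (ExteriorAlgebra K V) :=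
  ⋀[K]^k V ⊓ ⨅ g : G, LinearMap.eqLocus (ExteriorAlgebra.map (π g)).toLinearMap LinearMap.id

/-- The graded algebra with degree `k` part `R k` (in an ambient algebra `E`) has depth `n`, and
`a ∈ R 2` has the hard Lefschetz property for it: multiplication by `a ^ k` is a bijection
`R (n - k) → R (n + k)` for all `k` (for `k > n` both sides are zero). -/
structure HardLefschetz {E : Type*} [Ring E] [Algebra K E] (R : ℕ → Submodule K E)
    (n : ℕ) (a : E) : Prop where
  mem : a ∈ R 2
  top_ne : R (2 * n) ≠ ⊥
  eq_bot : ∀ k, 2 * n < k → R k = ⊥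
  bijOn : ∀ k ≤ n, Set.BijOn (fun x => a ^ k * x) (R (n - k)) (R (n + k))

/-- The isotypic setup: `ρ` is irreducible, `⋀² V` has a `G`-invariant element with the
hard Lefschetz property for both `⋀ V` and `(⋀ V)^G`, and `V ≅ ρ ^ n` if `ρ` is self-dual,
`V ≅ ρ ^ n ⊕ (ρ*) ^ n` otherwise. -/
structure IsotypicSetup (π : Representation K G V) (ρ : Representation K G W) : Prop where
  irreducible : ρ.IsIrreducible
  lefschetz : ∃ (n : ℕ) (a : ExteriorAlgebra K V),
    HardLefschetz (fun k => ⋀[K]^k V) n a ∧ HardLefschetz (extInvariants π) n a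
  isotypic : ∃ n : ℕ,
    (Nonempty (ρ.Equiv ρ.dual) → Nonempty (π.Equiv (repPow ρ n))) ∧
    (¬ Nonempty (ρ.Equiv ρ.dual) →
      Nonempty (π.Equiv ((repPow ρ n).prod (repPow ρ.dual n))))

theorem equiv_asAlgebraHom {π : Representation K G V} {ρ : Representation K G W}
    (e : π.Equiv ρ) (x : K[G]) (v : V) : e (π.asAlgebraHom x v) = ρ.asAlgebraHom x (e v) := by
  induction x using MonoidAlgebra.induction_linear with
  | zero => simp
  | add x y hx hy => simp only [map_add, LinearMap.add_apply, hx, hy]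
  | single g c =>
    have h : e (π g v) = ρ g (e v) :=
      Representation.IntertwiningMap.isIntertwining π ρ e.toIntertwiningMap g v
    simp [h]

theorem repPow_asAlgebraHom (ρ : Representation K G W) (n : ℕ) (x : K[G]) (w : Fin n → W)
    (i : Fin n) : (repPow ρ n).asAlgebraHom x w i = ρ.asAlgebraHom x (w i) := by
  induction x using MonoidAlgebra.induction_linear with
  | zero => simp
  | add x y hx hy => simp only [map_add, LinearMap.add_apply, Pi.add_apply, hx, hy]
  | single g c => simp [repPow]

theorem prod_asAlgebraHom (π : Representation K G V) (ρ : Representation K G W) (x : K[G])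
    (w : V × W) :
    (π.prod ρ).asAlgebraHom x w = (π.asAlgebraHom x w.1, ρ.asAlgebraHom x w.2) := by
  induction x using MonoidAlgebra.induction_linear with
  | zero => simp; rfl
  | add x y hx hy => simp only [map_add, LinearMap.add_apply, hx, hy, Prod.mk_add_mk]
  | single g c => simp [Representation.prod]

namespace IsotypicSetup

variable {π : Representation K G V} {ρ : Representation K G W} (h : IsotypicSetup π ρ)

theorem asAlgebraHom_eq_zero (h : IsotypicSetup π ρ) (x : K[G]) (hx : x ∈ factorIdeal ρ) : π.asAlgebraHom x = 0 := by
  rw [mem_factorIdeal] at hx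
  obtain ⟨n, h1, h2⟩ := h.isotypic
  ext v
  by_cases hd : Nonempty (ρ.Equiv ρ.dual)
  · obtain ⟨e⟩ := h1 hd
    apply e.toLinearEquiv.injective
    change e (π.asAlgebraHom x v) = e 0
    rw [equiv_asAlgebraHom, map_zero]
    ext i
    rw [repPow_asAlgebraHom, hx.1]; rfl
  · obtain ⟨e⟩ := h2 hd
    apply e.toLinearEquiv.injective
    change e (π.asAlgebraHom x v) = e 0
    rw [equiv_asAlgebraHom, map_zero, prod_asAlgebraHom]
    refine Prod.ext ?_ ?_
    · ext i
      dsimp only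
      rw [repPow_asAlgebraHom, hx.1]; rfl
    · dsimp only
      refine funext fun i => ?_
      rw [repPow_asAlgebraHom, hx.2]; rfl

/-- The `A`-module structure of `V`, through which `K[G]` acts. -/
def action : GroupAlgFactor ρ →ₐ[K] End K V :=
  Ideal.Quotient.liftₐ (factorIdeal ρ) π.asAlgebraHom h.asAlgebraHom_eq_zero

/-- The algebra `Ã = End_A(V ⊕ V*)`. -/
abbrev tildeA : Subalgebra K (End K (Tilde K V)) :=
  endTilde (factorInvolution ρ) h.action

variable [FiniteDimensional K V]

/-- The involution `σ̃` of `Ã`. -/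
abbrev tildeSigma : AlgInvolution K h.tildeA :=
  tildeInvolution (factorInvolution ρ) h.action

/-- The Lie algebra `𝔰(Ã, σ̃)`. -/
abbrev s : LieIdeal K h.tildeSigma.skew := h.tildeSigma.derivedSkew

/-- The endomorphism of `Ṽ` that underlies an element of `𝔰(Ã, σ̃)`. -/
def toEnd (x : h.s) : End K (Tilde K V) :=
  ((x : h.tildeSigma.skew) : h.tildeA).1

/-- The Lie subalgebra of `𝔰(Ã, σ̃)` generated by its elements in degrees `2` and `-2`. -/
def generated : LieSubalgebra K h.s :=
  LieSubalgebra.lieSpan K h.s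
    {x | EndHasDegree 2 (h.toEnd x) ∨ EndHasDegree (-2) (h.toEnd x)}

end IsotypicSetup

end Setup

/-- The Lie algebra `sl_2(F)` over `F`, viewed as a Lie algebra over `K`. -/
def slTwo (K F : Type*) [CommRing K] [CommRing F] [Algebra K F] :
    LieSubalgebra K (Matrix (Fin 2) (Fin 2) F) where
  toSubmodule := (LieAlgebra.SpecialLinear.sl (Fin 2) F).toSubmodule.restrictScalars K
  lie_mem' := fun hx hy => (LieAlgebra.SpecialLinear.sl (Fin 2) F).lie_mem hx hy

end

/-! Contracting the Lefschetz element with linear forms gives a $G$-equivariant alternating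
isomorphism $J : V^*\to V$ (`HardLefschetz.exists_symplectic`). Let $u$ send $V^*$ to $V$ by $J$ and
$v$ send $V$ to $V^*$ by $J^{-1}$. Both are skew elements of $\widetilde A$, with $u^2=v^2=0$ and
$uv+vu=1$, so $\widetilde A\cong M_2(C)$ for the centralizer $C$ of $u,v$, and $\widetilde\sigma$
restricts to an involution $\tau$ of $C$. The skew elements are $\mathrm{diag}(a)+bu+cv$ with
$\mathrm{diag}(a)=a\,uv-\tau(a)\,vu$ and $b,c$ symmetric for $\tau$; the summands have degrees
$0,2,-2$. As $[bu,cv]=\mathrm{diag}(bc)$, the elements of degrees $\pm2$ generate all commutators of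
skew elements as soon as every commutator of $C$ lies in the span $S$ of products of two symmetric
elements (`lieSpan_eq_top`).

If $\rho\not\cong\rho^*$, the element of $A$ acting by $1$ on $\rho$ and $-1$ on $\rho^*$ is central
and skew with square $1$. Multiplication by it exchanges symmetric and skew elements of $C$, so $S$
contains all commutators; it also prevents $\widetilde\sigma$ from being of the first kind.

If $\rho\cong\rho^*$ and $V\ne0$, then $\widetilde A$ and $C$ are simple. $S$ is a Lie ideal of $C$,
so by Herstein's theorem (`lieIdeal_central_or`) it contains all commutators unless it is central.
In the latter case either $C$ is commutative or its symmetric elements are exactly its centre. With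
$N=\dim C$ and $h$ the dimension of the symmetric part, both over the centre of $\widetilde A$, the
trace of $\widetilde\sigma$ is $2N-4h$; over an algebraic closure it is $\pm d$ with $d^2=4N$. For
$h=1$ and $N\ne1$ this forces $d=4$ and the orthogonal sign. Conversely, orthogonal of degree $4$
gives $h=1$; the double commutant theorem identifies the centre of $\widetilde A$ with $F$, and
$Fu$, $Fv$ generate $\mathfrak{sl}_2(F)$ (`exists_equiv_slTwo`). -/

/-! ### Lie ideals of simple rings -/

section Herstein

theorem isSimpleRing_of_surjective {R S : Type*} [Ring R] [Ring S] [IsSimpleRing R] [Nontrivial S]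
    (f : R →+* S) (hf : Function.Surjective f) : IsSimpleRing S := by
  refine ⟨{ exists_pair_ne := ⟨⊥, ⊤, bot_ne_top⟩, eq_bot_or_eq_top := fun I => ?_ }⟩
  rcases eq_bot_or_eq_top (TwoSidedIdeal.comap f I) with h | h
  · left
    refine le_antisymm (fun x hx => ?_) bot_le
    obtain ⟨y, rfl⟩ := hf x
    have hy : y ∈ TwoSidedIdeal.comap f I := by rwa [TwoSidedIdeal.mem_comap]
    rw [h, TwoSidedIdeal.mem_bot] at hy
    rw [hy, map_zero]
    exact TwoSidedIdeal.zero_mem _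
  · right
    rw [← TwoSidedIdeal.one_mem_iff]
    have h1 : (1 : R) ∈ TwoSidedIdeal.comap f I := by rw [h]; trivial
    rwa [TwoSidedIdeal.mem_comap, map_one] at h1

theorem isSimpleRing_of_matrix {B n : Type*} [Ring B] [Fintype n] [DecidableEq n] [Nonempty n]
    [IsSimpleRing (Matrix n n B)] : IsSimpleRing B :=
  ⟨(TwoSidedIdeal.orderIsoMatrix (R := B) (n := n)).isSimpleOrder⟩

variable {B : Type*} [Ring B] [IsSimpleRing B]

/-- An additive subgroup of a simple ring that absorbs multiplication and contains a nonzero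
element is the whole ring. -/
theorem IsSimpleRing.mem_of_absorbing (U : AddSubgroup B) (hl : ∀ x, ∀ y ∈ U, x * y ∈ U)
    (hr : ∀ x, ∀ y ∈ U, y * x ∈ U) {u : B} (hu : u ∈ U) (h0 : u ≠ 0) (x : B) : x ∈ U := by
  let I : TwoSidedIdeal B := TwoSidedIdeal.mk' U U.zero_mem (fun h h' => U.add_mem h h')
    (fun h => U.neg_mem h) (fun h => hl _ _ h) (fun h => hr _ _ h)
  have h1 : (1 : B) ∈ I :=
    IsSimpleRing.one_mem_of_ne_zero_mem I h0 ((TwoSidedIdeal.mem_mk' ..).2 hu)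
  have h2 : (1 : B) ∈ U := (TwoSidedIdeal.mem_mk' ..).1 h1
  simpa using hl x 1 h2

/-- A simple ring is prime. -/
theorem IsSimpleRing.eq_zero_of_mul_mul {a b : B} (h : ∀ y, a * y * b = 0) : a = 0 ∨ b = 0 := by
  by_contra! hab
  let U : AddSubgroup B :=
    { carrier := {x | ∀ y, a * y * x = 0}
      add_mem' := fun hx hy y => by rw [mul_add, hx y, hy y, add_zero]
      zero_mem' := fun y => mul_zero _
      neg_mem' := fun hx y => by rw [mul_neg, hx y, neg_zero] }
  have h1 : (1 : B) ∈ U := IsSimpleRing.mem_of_absorbing U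
    (fun x y hy z => by rw [← mul_assoc, mul_assoc a, hy])
    (fun x y hy z => by rw [← mul_assoc, hy, zero_mul]) (u := b) h hab.2 1
  exact hab.1 (by simpa using h1 1)

/-- If a Lie ideal `U` of a simple ring contains two elements that do not commute and is closed
under multiplication, it is everything. -/
theorem mem_of_lieIdeal_subring (U : AddSubgroup B) (hU : ∀ x, ∀ u ∈ U, x * u - u * x ∈ U)
    (hmul : ∀ x ∈ U, ∀ y ∈ U, x * y ∈ U) {u v : B} (hu : u ∈ U) (hv : v ∈ U)
    (huv : u * v - v * u ≠ 0) (x : B) : x ∈ U := by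
  -- Leibniz rule: $[u,v]r=[u,vr]-v[u,r]$.
  have key : ∀ r, (u * v - v * u) * r ∈ U := fun r => by
    have h1 := U.neg_mem (hU (v * r) u hu)
    have h2 := hmul v hv _ (hU r u hu)
    have h3 := U.add_mem h1 h2
    have e : -(v * r * u - u * (v * r)) + v * (r * u - u * r) = (u * v - v * u) * r := by noncomm_ring
    rwa [e] at h3
  -- With $c=[u,v]$, $scr=[s,cr]+c(rs)$, so the whole two-sided ideal generated by $c$ lies in `U`.
  have key2 : ∀ s r, s * (u * v - v * u) * r ∈ U := fun s r => by
    have h1 := hU s _ (key r)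
    have h2 := U.add_mem h1 (key (r * s))
    have e : s * ((u * v - v * u) * r) - (u * v - v * u) * r * s + (u * v - v * u) * (r * s)
      = s * (u * v - v * u) * r := by noncomm_ring
    rwa [e] at h2
  let I : AddSubgroup B :=
    { carrier := {x | ∀ s r, s * x * r ∈ U}
      add_mem' := fun hx hy s r => by rw [mul_add, add_mul]; exact U.add_mem (hx s r) (hy s r)
      zero_mem' := fun s r => by simp [U.zero_mem]
      neg_mem' := fun hx s r => by rw [mul_neg, neg_mul]; exact U.neg_mem (hx s r) }
  have hx : x ∈ I := IsSimpleRing.mem_of_absorbing I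
    (fun x y hy s r => by rw [← mul_assoc]; exact hy _ _)
    (fun x y hy s r => by rw [← mul_assoc, mul_assoc]; exact hy _ _)
    (u := u * v - v * u) key2 huv x
  simpa using hx 1 1

/-- Herstein: a Lie ideal of a simple ring of characteristic not `2` is central or contains all
commutators. -/
theorem lieIdeal_central_or (h2 : ∀ x : B, x + x = 0 → x = 0) (U : AddSubgroup B)
    (hU : ∀ x, ∀ u ∈ U, x * u - u * x ∈ U) :
    (∀ u ∈ U, ∀ x, x * u = u * x) ∨ ∀ x y : B, x * y - y * x ∈ U := by
  by_cases hc : ∀ u ∈ U, ∀ v ∈ U, u * v - v * u = 0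
  · left
    intro u hu x
    -- $[u,r]$ lies in the commutative $U$ together with $u$, so $(\mathrm{ad}\,u)^2=0$.
    have hd : ∀ r, (u * r - r * u) * u = u * (u * r - r * u) := fun r => by
      have h := hc u hu _ (hU r u hu)
      have e : u * (u * r - r * u) - (u * r - r * u) * u =
        -(u * (r * u - u * r) - (r * u - u * r) * u) := by noncomm_ring
      rw [h, neg_zero] at e
      exact (sub_eq_zero.1 e).symm
    -- Expanding $(\mathrm{ad}\,u)^2(ab)=0$ leaves only the cross term $2[u,a][u,b]$.
    have hdd : ∀ a b, (u * a - a * u) * (u * b - b * u) = 0 := fun a b => by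
      apply h2
      have hab := hd (a * b)
      have e : u * (u * (a * b) - a * b * u) - (u * (a * b) - a * b * u) * u
          = (u * a - a * u) * (u * b - b * u) + (u * a - a * u) * (u * b - b * u)
            + (u * (u * a - a * u) - (u * a - a * u) * u) * b
            + a * (u * (u * b - b * u) - (u * b - b * u) * u) := by noncomm_ring
      rw [hab, hd a, hd b] at e
      simpa using e.symm
    -- Taking $a=x$, $b=yx$ gives $[u,x]\,y\,[u,x]=0$ for all $y$, and primeness yields $[u,x]=0$.
    have h3 : ∀ y, (u * x - x * u) * y * (u * x - x * u) = 0 := fun y => by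
      have h := hdd x (y * x)
      have e : (u * x - x * u) * (u * (y * x) - y * x * u) =
        (u * x - x * u) * (u * y - y * u) * x + (u * x - x * u) * y * (u * x - x * u) := by
        noncomm_ring
      rw [h, hdd x y, zero_mul, zero_add] at e
      exact e.symm
    have h4 := IsSimpleRing.eq_zero_of_mul_mul h3
    rw [or_self, sub_eq_zero] at h4
    exact h4.symm
  · right
    push Not at hc
    obtain ⟨u, hu, v, hv, huv⟩ := hc
    -- $T=\{x : [x,B]\subseteq U\}$ is a Lie ideal closed under multiplication, because
    -- $[xy,r]=[x,yr]+[y,rx]$. It contains $U$, hence two non-commuting elements, so it is all of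
    -- $B$.
    let T : AddSubgroup B :=
      { carrier := {x | ∀ r, x * r - r * x ∈ U}
        add_mem' := fun {x y} hx hy r => by
          have e : (x + y) * r - r * (x + y) = (x * r - r * x) + (y * r - r * y) := by noncomm_ring
          rw [e]; exact U.add_mem (hx r) (hy r)
        zero_mem' := fun r => by simp [U.zero_mem]
        neg_mem' := fun {x} hx r => by
          have e : (-x) * r - r * (-x) = -(x * r - r * x) := by noncomm_ring
          rw [e]; exact U.neg_mem (hx r) }
    have hUT : ∀ x ∈ U, x ∈ T := fun x hx r => by
      rw [← neg_sub]; exact U.neg_mem (hU r x hx)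
    intro x y
    refine mem_of_lieIdeal_subring T (fun x t ht => hUT _ ?_) (fun x hx y hy r => ?_)
      (hUT u hu) (hUT v hv) huv x y
    · rw [← neg_sub]; exact U.neg_mem (ht x)
    · have e : x * y * r - r * (x * y) = (x * (y * r) - y * r * x) + (y * (r * x) - r * x * y) := by
        noncomm_ring
      rw [e]; exact U.add_mem (hx _) (hy _)

end Herstein

/-! ### Products of symmetric elements -/

namespace AlgInvolution

theorem apply_one {K B : Type*} [CommRing K] [Ring B] [Algebra K B] (τ : AlgInvolution K B) :
    τ 1 = 1 := by
  have h := τ.map_mul_rev (τ 1) 1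
  rw [mul_one, τ.apply_apply, mul_one] at h
  exact h.symm

variable {K B : Type*} [Field K] [Ring B] [Algebra K B] (τ : AlgInvolution K B)

/-- The span of the products of two symmetric elements. -/
def symMul : Submodule K B :=
  Submodule.span K {x | ∃ b c, τ b = b ∧ τ c = c ∧ x = b * c}

variable {τ}

theorem mul_mem_symMul {b c : B} (hb : τ b = b) (hc : τ c = c) : b * c ∈ τ.symMul :=
  Submodule.subset_span ⟨b, c, hb, hc, rfl⟩

theorem mem_symMul {b : B} (hb : τ b = b) : b ∈ τ.symMul := by
  simpa using mul_mem_symMul hb τ.apply_one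

theorem apply_add_apply (x : B) : τ (x + τ x) = x + τ x := by
  rw [map_add, τ.apply_apply, add_comm]

theorem apply_sub_apply (x : B) : τ (x - τ x) = -(x - τ x) := by
  rw [map_sub, τ.apply_apply, neg_sub]

/-- Write $2bc=(bc+cb)+(bc-cb)$. The first term is symmetric, so its bracket with $h$ is a
difference of products of symmetric elements; the second is skew, so its bracket with $h$ is itself
symmetric. -/
theorem lie_sym_mem_symMul {h b c : B} (hh : τ h = h) (hb : τ b = b) (hc : τ c = c) :
    (2 : K) • (h * (b * c) - b * c * h) ∈ τ.symMul := by
  have h1 : τ (b * c + c * b) = b * c + c * b := by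
    rw [map_add, τ.map_mul_rev, τ.map_mul_rev, hb, hc, add_comm]
  have h2 : τ (h * (b * c - c * b) - (b * c - c * b) * h) =
      h * (b * c - c * b) - (b * c - c * b) * h := by
    simp only [map_sub, τ.map_mul_rev, hb, hc, hh]
    noncomm_ring
  have e : (2 : K) • (h * (b * c) - b * c * h) =
      h * (b * c + c * b) - (b * c + c * b) * h + (h * (b * c - c * b) - (b * c - c * b) * h) := by
    rw [two_smul]; noncomm_ring
  rw [e]
  exact add_mem (sub_mem (mul_mem_symMul hh h1) (mul_mem_symMul h1 hh)) (mem_symMul h2)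

theorem apply_lie_skew {s b : B} (hs : τ s = -s) (hb : τ b = b) :
    τ (s * b - b * s) = s * b - b * s := by
  simp only [map_sub, τ.map_mul_rev, hs, hb]
  noncomm_ring

theorem lie_skew_mem_symMul {s b c : B} (hs : τ s = -s) (hb : τ b = b) (hc : τ c = c) :
    s * (b * c) - b * c * s ∈ τ.symMul := by
  have e : s * (b * c) - b * c * s = (s * b - b * s) * c + b * (s * c - c * s) := by noncomm_ring
  rw [e]
  exact add_mem (mul_mem_symMul (apply_lie_skew hs hb) hc)
    (mul_mem_symMul hb (apply_lie_skew hs hc))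

variable [CharZero K]

/-- The span of products is a Lie ideal, which is what Herstein's dichotomy needs. Split $2x$ into
its symmetric and skew parts; the factor $4$ combines this $2$ with the one in the symmetric case.
-/
theorem lie_mem_symMul (x : B) {u : B} (hu : u ∈ τ.symMul) : x * u - u * x ∈ τ.symMul := by
  induction hu using Submodule.span_induction with
  | mem u hu =>
    obtain ⟨b, c, hb, hc, rfl⟩ := hu
    have h1 := lie_sym_mem_symMul (apply_add_apply (τ := τ) x) hb hc
    have h2 := lie_skew_mem_symMul (apply_sub_apply (τ := τ) x) hb hc
    have h3 := add_mem h1 (Submodule.smul_mem _ (2 : K) h2)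
    have e : (2 : K) • ((x + τ x) * (b * c) - b * c * (x + τ x)) +
        (2 : K) • ((x - τ x) * (b * c) - b * c * (x - τ x)) =
        (4 : K) • (x * (b * c) - b * c * x) := by
      rw [← smul_add, show (4 : K) = 2 * 2 by norm_num, mul_smul, two_smul K (x * _ - _)]
      congr 1
      noncomm_ring
    rw [e] at h3
    exact (Submodule.smul_mem_iff _ (by norm_num)).1 h3
  | zero => simp
  | add u v _ _ hu hv =>
    have e : x * (u + v) - (u + v) * x = (x * u - u * x) + (x * v - v * x) := by noncomm_ring
    rw [e]; exact add_mem hu hv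
  | smul c u _ hu =>
    rw [mul_smul_comm, smul_mul_assoc, ← smul_sub]
    exact Submodule.smul_mem _ _ hu

/-- If there is a central skew-symmetric square root of `1`, every commutator is a combination of
products of symmetric elements. -/
theorem commutator_mem_symMul_of_central {e : B} (he : ∀ x, e * x = x * e) (hee : e * e = 1)
    (hτ : τ e = -e) (x y : B) : x * y - y * x ∈ τ.symMul := by
  -- Multiplication by $e$ makes skew elements symmetric, and $(es)(et)=st$: products of two skew
  -- elements are products of two symmetric ones.
  have hs : ∀ s, τ s = -s → τ (e * s) = e * s := fun s h => by
    rw [τ.map_mul_rev, h, hτ, neg_mul_neg, he]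
  have hss : ∀ s t, e * s * (e * t) = s * t := fun s t => by
    rw [he s, mul_assoc, ← mul_assoc e, hee, one_mul]
  have hx := apply_add_apply (τ := τ) x
  have hy := apply_add_apply (τ := τ) y
  have hx' := apply_sub_apply (τ := τ) x
  have hy' := apply_sub_apply (τ := τ) y
  have h1 := sub_mem (mul_mem_symMul hx hy) (mul_mem_symMul hy hx)
  have h2 := mem_symMul (apply_lie_skew hx' hy)
  have h3 := mem_symMul (apply_lie_skew hy' hx)
  have h4 := sub_mem (mul_mem_symMul (hs _ hx') (hs _ hy')) (mul_mem_symMul (hs _ hy') (hs _ hx'))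
  rw [hss, hss] at h4
  have h5 := add_mem (sub_mem (add_mem h1 h2) h3) h4
  -- $4[x,y]$ is the bracket of $2x$ and $2y$, each split into symmetric and skew parts; the mixed
  -- brackets are symmetric.
  refine (Submodule.smul_mem_iff _ (show (4 : K) ≠ 0 by norm_num)).1 ?_
  convert h5 using 1
  rw [show (4 : K) = 2 + 2 by norm_num, add_smul, two_smul]
  noncomm_ring

/-- In a simple algebra with involution, the commutators are combinations of products of symmetric
elements, unless the algebra is non-commutative and the symmetric elements are exactly the central
ones. -/
theorem commutator_mem_symMul_of_simple [IsSimpleRing B]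
    (h : ¬ ((∀ b, τ b = b ↔ b ∈ Subring.center B) ∧ ∃ x y : B, x * y ≠ y * x)) (x y : B) :
    x * y - y * x ∈ τ.symMul := by
  have h2 : ∀ x : B, x + x = 0 → x = 0 := fun x hx => by
    rw [← two_smul K] at hx
    exact (smul_eq_zero_iff_right two_ne_zero).1 hx
  rcases lieIdeal_central_or h2 τ.symMul.toAddSubgroup (fun x u hu => lie_mem_symMul x hu) with
    hc | hc
  swap
  · exact hc x y
  -- Central alternative: symmetric elements are central. It remains to exclude a central element
  -- $b$ that is not symmetric, unless $x$ and $y$ commute.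
  have hH : ∀ b, τ b = b → ∀ x, x * b = b * x := fun b hb => hc b (mem_symMul hb)
  by_contra hxy
  refine h ⟨fun b => ⟨fun hb => Subring.mem_center_iff.2 (hH b hb), fun hb => ?_⟩, x, y,
    fun e => hxy (by rw [e, sub_self]; exact zero_mem _)⟩
  by_contra hne
  have hb' : τ b ∈ Subring.center B := Subring.mem_center_iff.2 fun z => by
    have := congrArg τ (Subring.mem_center_iff.1 hb (τ z))
    rw [τ.map_mul_rev, τ.map_mul_rev, τ.apply_apply] at this
    exact this.symm
  have he := Subring.mem_center_iff.1 (sub_mem hb hb')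
  -- $b-\tau(b)$ is a nonzero central skew element. Its product with a skew $s$ is symmetric, hence
  -- central, and primeness cancels the factor: $s$ is central too, so the algebra is commutative.
  have hS : ∀ s, τ s = -s → ∀ z, z * s = s * z := fun s hs z => by
    have h1 : τ ((b - τ b) * s) = (b - τ b) * s := by
      rw [τ.map_mul_rev, hs, apply_sub_apply, neg_mul_neg, he]
    have h3 : ∀ w, (b - τ b) * w * (z * s - s * z) = 0 := fun w => by
      have e1 := hH _ h1 z
      rw [← he w, mul_assoc, mul_sub, ← mul_assoc _ z s, ← he z, mul_assoc z, e1, mul_assoc,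
        sub_self, mul_zero]
    rcases IsSimpleRing.eq_zero_of_mul_mul h3 with h4 | h4
    · exact absurd (sub_eq_zero.1 h4).symm hne
    · exact sub_eq_zero.1 h4
  refine hxy ?_
  have hx1 := hH _ (apply_add_apply (τ := τ) x) y
  have hx2 := hS _ (apply_sub_apply (τ := τ) x) y
  have h5 : y * (x + x) = (x + x) * y := by
    have e : x + x = (x + τ x) + (x - τ x) := by abel
    rw [e, mul_add, add_mul, hx1, hx2]
  have h6 : x * y - y * x = 0 := h2 _ (by
    rw [mul_add, add_mul] at h5
    rw [sub_add_sub_comm, h5, sub_self])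
  rw [h6]
  exact zero_mem _

end AlgInvolution

/-! ### Hyperbolic pairs -/

/-- Two skew-symmetric elements `u`, `v` that generate a copy of the algebra of `2 × 2` matrices,
as the matrix units `e₁₂` and `e₂₁`. -/
structure IsHyperbolicPair {K R : Type*} [CommRing K] [Ring R] [Algebra K R]
    (σ : AlgInvolution K R) (u v : R) : Prop where
  mul_self_left : u * u = 0
  mul_self_right : v * v = 0
  add_eq_one : u * v + v * u = 1
  skew_left : σ u = -u
  skew_right : σ v = -v

set_option linter.unusedSimpArgs false

namespace IsHyperbolicPair

variable {K R : Type*} [Field K] [Ring R] [Algebra K R] {σ : AlgInvolution K R} {u v : R}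
  (p : IsHyperbolicPair σ u v)

include p in
theorem uvu : u * (v * u) = u := by
  have h : v * u = 1 - u * v := by rw [← p.add_eq_one]; abel
  rw [h, mul_sub, mul_one, ← mul_assoc, p.mul_self_left, zero_mul, sub_zero]

include p in
theorem vuv : v * (u * v) = v := by
  have h : u * v = 1 - v * u := by rw [← p.add_eq_one]; abel
  rw [h, mul_sub, mul_one, ← mul_assoc, p.mul_self_right, zero_mul, sub_zero]

-- The suffix `X` marks versions with a trailing factor: they let `simp` reduce right-associated
-- words in $u$, $v$ to normal form.
include p in
theorem uuX (x : R) : u * (u * x) = 0 := by rw [← mul_assoc, p.mul_self_left, zero_mul]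

include p in
theorem vvX (x : R) : v * (v * x) = 0 := by rw [← mul_assoc, p.mul_self_right, zero_mul]

include p in
theorem uvuX (x : R) : u * (v * (u * x)) = u * x := by
  rw [← mul_assoc v, ← mul_assoc, p.uvu]

include p in
theorem vuvX (x : R) : v * (u * (v * x)) = v * x := by
  rw [← mul_assoc u, ← mul_assoc, p.vuv]

/-- The centralizer of a hyperbolic pair. -/
abbrev core (_ : IsHyperbolicPair σ u v) : Subalgebra K R := Subalgebra.centralizer K {u, v}

theorem mem_core {x : R} : x ∈ p.core ↔ u * x = x * u ∧ v * x = x * v := by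
  simp [Subalgebra.mem_centralizer_iff]

theorem u_comm (b : p.core) : u * (b : R) = b * u := (p.mem_core.1 b.2).1

theorem v_comm (b : p.core) : v * (b : R) = b * v := (p.mem_core.1 b.2).2

theorem u_commX (b : p.core) (x : R) : u * ((b : R) * x) = b * (u * x) := by
  rw [← mul_assoc, p.u_comm, mul_assoc]

theorem v_commX (b : p.core) (x : R) : v * ((b : R) * x) = b * (v * x) := by
  rw [← mul_assoc, p.v_comm, mul_assoc]

/-- The involution on the centralizer of a hyperbolic pair. -/
def coreInvolution : AlgInvolution K p.core where
  toFun b := ⟨σ b, by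
    have h1 := congrArg σ (p.u_comm b)
    have h2 := congrArg σ (p.v_comm b)
    rw [σ.map_mul_rev, σ.map_mul_rev, p.skew_left, mul_neg, neg_mul, neg_inj] at h1
    rw [σ.map_mul_rev, σ.map_mul_rev, p.skew_right, mul_neg, neg_mul, neg_inj] at h2
    exact p.mem_core.2 ⟨h1.symm, h2.symm⟩⟩
  map_add' x y := Subtype.ext (map_add _ _ _)
  map_smul' c x := Subtype.ext (map_smul _ _ _)
  map_mul_rev' x y := Subtype.ext (σ.map_mul_rev _ _)
  involutive' x := Subtype.ext (σ.apply_apply _)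

theorem coe_coreInvolution (b : p.core) : (p.coreInvolution b : R) = σ b := rfl

/-- The component of an element at the matrix unit `(1, 1)`. -/
def comp11 (r : R) : p.core := ⟨u * v * r * (u * v) + v * r * u, p.mem_core.2 (by
  constructor <;> simp only [mul_add, add_mul, mul_assoc, p.mul_self_left, p.mul_self_right, p.uvu,
    p.vuv, p.uuX, p.vvX, p.uvuX, p.vuvX, mul_zero, add_zero, zero_add])⟩

/-- The component of an element at the matrix unit `(1, 2)`. -/
def comp12 (r : R) : p.core := ⟨u * v * r * v + v * r * (v * u), p.mem_core.2 (by
  constructor <;> simp only [mul_add, add_mul, mul_assoc, p.mul_self_left, p.mul_self_right, p.uvu,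
    p.vuv, p.uuX, p.vvX, p.uvuX, p.vuvX, mul_zero, add_zero, zero_add])⟩

/-- The component of an element at the matrix unit `(2, 1)`. -/
def comp21 (r : R) : p.core := ⟨u * r * (u * v) + v * u * r * u, p.mem_core.2 (by
  constructor <;> simp only [mul_add, add_mul, mul_assoc, p.mul_self_left, p.mul_self_right, p.uvu,
    p.vuv, p.uuX, p.vvX, p.uvuX, p.vuvX, mul_zero, add_zero, zero_add])⟩

/-- The component of an element at the matrix unit `(2, 2)`. -/
def comp22 (r : R) : p.core := ⟨u * r * v + v * u * r * (v * u), p.mem_core.2 (by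
  constructor <;> simp only [mul_add, add_mul, mul_assoc, p.mul_self_left, p.mul_self_right, p.uvu,
    p.vuv, p.uuX, p.vvX, p.uvuX, p.vuvX, mul_zero, add_zero, zero_add])⟩

theorem decomp (r : R) : (p.comp11 r : R) * (u * v) + (p.comp12 r : R) * u +
    (p.comp21 r : R) * v + (p.comp22 r : R) * (v * u) = r := by
  have e : r = (u * v + v * u) * r * (u * v + v * u) := by rw [p.add_eq_one, one_mul, mul_one]
  conv_rhs => rw [e]
  simp only [comp11, comp12, comp21, comp22, mul_add, add_mul, mul_assoc, p.mul_self_left,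
    p.mul_self_right, p.uvu, p.vuv, p.uuX, p.vvX, p.uvuX, p.vuvX, mul_zero, add_zero, zero_add]
  abel

/-- The element with given components. -/
def ofComp (a b c d : p.core) : R := a * (u * v) + b * u + c * v + d * (v * u)

theorem comp_ofComp (a b c d : p.core) : p.comp11 (p.ofComp a b c d) = a ∧
    p.comp12 (p.ofComp a b c d) = b ∧ p.comp21 (p.ofComp a b c d) = c ∧
    p.comp22 (p.ofComp a b c d) = d := by
  have key : ∀ x : R, x * (u * v) + x * (v * u) = x := fun x => by
    rw [← mul_add, p.add_eq_one, mul_one]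
  refine ⟨Subtype.ext ?_, Subtype.ext ?_, Subtype.ext ?_, Subtype.ext ?_⟩ <;>
  · simp only [ofComp, comp11, comp12, comp21, comp22, mul_add, add_mul, mul_assoc,
      p.mul_self_left, p.mul_self_right, p.uvu, p.vuv, p.uuX, p.vvX, p.uvuX, p.vuvX, p.u_comm,
      p.v_comm, p.u_commX, p.v_commX, mul_zero, add_zero, zero_add]
    exact key _

/-- An algebra with a hyperbolic pair is an algebra of `2 × 2` matrices. -/
def matrixHom : Matrix (Fin 2) (Fin 2) p.core →ₐ[K] R where
  toFun M := p.ofComp (M 0 0) (M 0 1) (M 1 0) (M 1 1)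
  map_one' := by simp [ofComp, p.add_eq_one]
  map_zero' := by simp [ofComp]
  map_add' M N := by simp only [ofComp, Matrix.add_apply, Subalgebra.coe_add, add_mul]; abel
  map_mul' M N := by
    simp only [ofComp, Matrix.mul_apply, Fin.sum_univ_two, Subalgebra.coe_add, Subalgebra.coe_mul,
      mul_add, add_mul, mul_assoc, p.mul_self_left, p.mul_self_right, p.uvu, p.vuv, p.uuX, p.vvX,
      p.uvuX, p.vuvX, p.u_comm, p.v_comm, p.u_commX, p.v_commX, mul_zero, add_zero, zero_add]
    abel
  commutes' c := by
    simp only [ofComp, Matrix.algebraMap_matrix_apply]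
    simp only [Subalgebra.coe_algebraMap, if_true, Fin.zero_eq_one_iff, Fin.one_eq_zero_iff,
      OfNat.ofNat_ne_one, if_false, ZeroMemClass.coe_zero, zero_mul, add_zero]
    rw [← mul_add, p.add_eq_one, mul_one]

/-- The isomorphism with the algebra of `2 × 2` matrices over the centralizer. -/
noncomputable def matrixEquiv : Matrix (Fin 2) (Fin 2) p.core ≃ₐ[K] R :=
  AlgEquiv.ofBijective p.matrixHom ⟨fun M N h => by
    have hM := p.comp_ofComp (M 0 0) (M 0 1) (M 1 0) (M 1 1)
    have hN := p.comp_ofComp (N 0 0) (N 0 1) (N 1 0) (N 1 1)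
    have h' : p.ofComp (M 0 0) (M 0 1) (M 1 0) (M 1 1) = p.ofComp (N 0 0) (N 0 1) (N 1 0) (N 1 1) :=
      h
    rw [h'] at hM
    ext i j
    fin_cases i <;> fin_cases j
    · exact congrArg Subtype.val (hM.1.symm.trans hN.1)
    · exact congrArg Subtype.val (hM.2.1.symm.trans hN.2.1)
    · exact congrArg Subtype.val (hM.2.2.1.symm.trans hN.2.2.1)
    · exact congrArg Subtype.val (hM.2.2.2.symm.trans hN.2.2.2),
    fun r => ⟨!![p.comp11 r, p.comp12 r; p.comp21 r, p.comp22 r], p.decomp r⟩⟩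

theorem finrank_eq [FiniteDimensional K R] : finrank K R = 4 * finrank K p.core := by
  rw [← p.matrixEquiv.toLinearEquiv.finrank_eq, finrank_matrix]
  simp

theorem isSimpleRing_core [IsSimpleRing R] : IsSimpleRing p.core := by
  have : IsSimpleRing (Matrix (Fin 2) (Fin 2) p.core) :=
    isSimpleRing_of_surjective p.matrixEquiv.symm.toRingEquiv.toRingHom
      p.matrixEquiv.symm.surjective
  exact isSimpleRing_of_matrix (n := Fin 2)

theorem mem_center_of_mem_center_core {b : p.core} (hb : b ∈ Subring.center p.core) :
    (b : R) ∈ Subring.center R := by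
  rw [Subring.mem_center_iff] at hb ⊢
  have hb' : ∀ c : p.core, (c : R) * b = b * c := fun c => congrArg Subtype.val (hb c)
  intro r
  rw [← p.decomp r]
  simp only [add_mul, mul_add, mul_assoc, p.u_comm, p.v_comm, p.u_commX, p.v_commX]
  simp only [← mul_assoc, hb']

include p in
theorem mem_core_of_mem_center {z : R} (hz : z ∈ Subring.center R) : z ∈ p.core := by
  rw [Subring.mem_center_iff] at hz
  exact p.mem_core.2 ⟨hz u, hz v⟩

/-! ### The Lie algebra of skew-symmetric elements -/

/-- As $\sigma$ negates $u$ and $v$, it exchanges $uv$ and $vu$. On matrices it is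
$\begin{pmatrix}a&b\\c&d\end{pmatrix}\mapsto\begin{pmatrix}\tau d&-\tau b\\-\tau c&\tau
a\end{pmatrix}$, with $\tau$ the involution of the centralizer. -/
theorem sigma_comp11 (r : R) : p.coreInvolution (p.comp11 r) = p.comp22 (σ r) := by
  apply Subtype.ext
  simp only [coe_coreInvolution, comp11, comp22, map_add, σ.map_mul_rev, p.skew_left, p.skew_right]
  noncomm_ring

theorem sigma_comp12 (r : R) : p.coreInvolution (p.comp12 r) = -p.comp12 (σ r) := by
  apply Subtype.ext
  simp only [coe_coreInvolution, comp12, map_add, σ.map_mul_rev, p.skew_left, p.skew_right,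
    NegMemClass.coe_neg]
  noncomm_ring

theorem sigma_comp21 (r : R) : p.coreInvolution (p.comp21 r) = -p.comp21 (σ r) := by
  apply Subtype.ext
  simp only [coe_coreInvolution, comp21, map_add, σ.map_mul_rev, p.skew_left, p.skew_right,
    NegMemClass.coe_neg]
  noncomm_ring

theorem comp_neg (r : R) : p.comp12 (-r) = -p.comp12 r ∧ p.comp21 (-r) = -p.comp21 r ∧
    p.comp22 (-r) = -p.comp22 r := by
  refine ⟨Subtype.ext ?_, Subtype.ext ?_, Subtype.ext ?_⟩ <;>
  · simp only [comp12, comp21, comp22, NegMemClass.coe_neg]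
    noncomm_ring

/-- The skew-symmetric element of degree `0` with a given component. -/
def diag (a : p.core) : R := a * (u * v) - p.coreInvolution a * (v * u)

theorem exists_of_skew {x : R} (hx : σ x = -x) : ∃ a b c : p.core,
    p.coreInvolution b = b ∧ p.coreInvolution c = c ∧ x = p.diag a + b * u + c * v := by
  refine ⟨p.comp11 x, p.comp12 x, p.comp21 x, ?_, ?_, ?_⟩
  · rw [sigma_comp12, hx, (p.comp_neg x).1, neg_neg]
  · rw [sigma_comp21, hx, (p.comp_neg x).2.1, neg_neg]
  · have h := p.decomp x
    rw [diag, sigma_comp11, hx, (p.comp_neg x).2.2]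
    conv_lhs => rw [← h]
    simp only [NegMemClass.coe_neg]
    noncomm_ring

theorem skew_u {b : p.core} (hb : p.coreInvolution b = b) : σ (b * u) = -(b * u) := by
  rw [σ.map_mul_rev, p.skew_left, ← coe_coreInvolution, hb, neg_mul, p.u_comm]

theorem skew_v {b : p.core} (hb : p.coreInvolution b = b) : σ (b * v) = -(b * v) := by
  rw [σ.map_mul_rev, p.skew_right, ← coe_coreInvolution, hb, neg_mul, p.v_comm]

theorem skew_diag (a : p.core) : σ (p.diag a) = -p.diag a := by
  simp only [diag, map_sub, σ.map_mul_rev, p.skew_left, p.skew_right, coe_coreInvolution,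
    σ.apply_apply, neg_mul_neg]
  rw [← coe_coreInvolution]
  simp only [mul_assoc, p.u_comm, p.v_comm, p.u_commX, p.v_commX]
  abel

theorem diag_add (a b : p.core) : p.diag (a + b) = p.diag a + p.diag b := by
  simp only [diag, map_add, Subalgebra.coe_add, add_mul]; abel

theorem diag_smul (k : K) (a : p.core) : p.diag (k • a) = k • p.diag a := by
  simp only [diag, map_smul, Subalgebra.coe_smul, smul_mul_assoc, smul_sub]

/-- The degree $0$ part is a copy of the centralizer with its commutator bracket; it acts on the
parts of degrees $\pm2$ by $b\mapsto ab+b\tau(a)$ and $b\mapsto-(\tau(a)b+ba)$. -/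
theorem lie_diag_diag (a b : p.core) :
    p.diag a * p.diag b - p.diag b * p.diag a = p.diag (a * b - b * a) := by
  simp only [diag, map_sub, AlgInvolution.map_mul_rev, Subalgebra.coe_sub, Subalgebra.coe_mul,
    mul_sub, sub_mul, mul_assoc, p.mul_self_left, p.mul_self_right, p.uvu, p.vuv, p.uuX, p.vvX,
    p.uvuX, p.vuvX, p.u_comm, p.v_comm, p.u_commX, p.v_commX, mul_zero, sub_zero, zero_sub]
  abel

theorem lie_diag_u (a b : p.core) : p.diag a * (b * u) - b * u * p.diag a =
    (a * b + b * p.coreInvolution a : p.core) * u := by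
  simp only [diag, Subalgebra.coe_add, Subalgebra.coe_mul, add_mul,
    mul_sub, sub_mul, mul_assoc, p.mul_self_left, p.mul_self_right, p.uvu, p.vuv, p.uuX, p.vvX,
    p.uvuX, p.vuvX, p.u_comm, p.v_comm, p.u_commX, p.v_commX, mul_zero, sub_zero, zero_sub]
  abel

theorem lie_diag_v (a b : p.core) : p.diag a * (b * v) - b * v * p.diag a =
    (-(p.coreInvolution a * b + b * a) : p.core) * v := by
  simp only [diag, Subalgebra.coe_add, Subalgebra.coe_mul, add_mul, NegMemClass.coe_neg, neg_mul,
    mul_sub, sub_mul, mul_assoc, p.mul_self_left, p.mul_self_right, p.uvu, p.vuv, p.uuX, p.vvX,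
    p.uvuX, p.vuvX, p.u_comm, p.v_comm, p.u_commX, p.v_commX, mul_zero, sub_zero, zero_sub]
  abel

/-- The source of the products of two symmetric elements: they are what degrees $2$ and $-2$ produce
in degree $0$. -/
theorem lie_u_v {b c : p.core} (hb : p.coreInvolution b = b) (hc : p.coreInvolution c = c) :
    b * u * (c * v) - c * v * (b * u) = p.diag (b * c) := by
  simp only [diag, AlgInvolution.map_mul_rev, hb, hc, Subalgebra.coe_mul,
    mul_assoc, p.u_comm, p.v_comm, p.u_commX, p.v_commX]

/-- If all commutators of the centralizer are combinations of products of symmetric elements, the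
commutators of skew-symmetric elements lie in every Lie subalgebra that contains the skew-symmetric
elements `b u` and `c v`. -/
theorem commutator_mem_of_symMul (hp : ∀ x y, x * y - y * x ∈ p.coreInvolution.symMul)
    (N : Submodule K R) (hN : ∀ x ∈ N, ∀ y ∈ N, x * y - y * x ∈ N)
    (hu : ∀ b, p.coreInvolution b = b → (b * u : R) ∈ N)
    (hv : ∀ b, p.coreInvolution b = b → (b * v : R) ∈ N)
    {x y : R} (hx : σ x = -x) (hy : σ y = -y) : x * y - y * x ∈ N := by
  have hd : ∀ a ∈ p.coreInvolution.symMul, p.diag a ∈ N := fun a ha => by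
    induction ha using Submodule.span_induction with
    | mem a ha =>
      obtain ⟨b, c, hb, hc, rfl⟩ := ha
      rw [← p.lie_u_v hb hc]
      exact hN _ (hu b hb) _ (hv c hc)
    | zero => simp [diag]
    | add a b _ _ ha hb => rw [p.diag_add]; exact add_mem ha hb
    | smul k a _ ha => rw [p.diag_smul]; exact Submodule.smul_mem _ _ ha
  have hdu : ∀ a b, p.coreInvolution b = b → p.diag a * (b * u) - b * u * p.diag a ∈ N :=
    fun a b hb => by
      rw [lie_diag_u]
      refine hu _ ?_
      rw [map_add, AlgInvolution.map_mul_rev, AlgInvolution.map_mul_rev, AlgInvolution.apply_apply,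
        hb, add_comm]
  have hdv : ∀ a b, p.coreInvolution b = b → p.diag a * (b * v) - b * v * p.diag a ∈ N :=
    fun a b hb => by
      rw [lie_diag_v]
      refine hv _ ?_
      rw [map_neg, map_add, AlgInvolution.map_mul_rev, AlgInvolution.map_mul_rev,
        AlgInvolution.apply_apply, hb, add_comm]
  obtain ⟨a, b, c, hb, hc, rfl⟩ := p.exists_of_skew hx
  obtain ⟨a', b', c', hb', hc', rfl⟩ := p.exists_of_skew hy
  have h1 := hd _ (hp a a')
  rw [← p.lie_diag_diag] at h1
  have h2 := sub_mem (hdu a b' hb') (hdu a' b hb)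
  have h3 := sub_mem (hdv a c' hc') (hdv a' c hc)
  have h4 := hN _ (add_mem (hu b hb) (hv c hc)) _ (add_mem (hu b' hb') (hv c' hc'))
  convert add_mem (add_mem (add_mem h1 h2) h3) h4 using 1
  simp only [mul_add, add_mul]
  abel

/-- The dimension of the Lie algebra of skew-symmetric elements. -/
theorem finrank_skew [FiniteDimensional K R] : finrank K σ.skew = finrank K p.core +
    2 * finrank K (LinearMap.eqLocus p.coreInvolution.toLinearMap LinearMap.id) := by
  set H := LinearMap.eqLocus p.coreInvolution.toLinearMap LinearMap.id
  have hH : ∀ b : H, p.coreInvolution b = b := fun b => b.2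
  let f : (p.core × H × H) →ₗ[K] σ.skew :=
    { toFun := fun t => ⟨p.diag t.1 + t.2.1 * u + t.2.2 * v, by
        change σ _ = - _
        rw [map_add, map_add, p.skew_diag, p.skew_u (hH t.2.1), p.skew_v (hH t.2.2)]
        abel⟩
      map_add' := fun s t => Subtype.ext (by
        simp only [Prod.fst_add, Prod.snd_add, p.diag_add, Submodule.coe_add, Subalgebra.coe_add,
          add_mul, AddMemClass.coe_add]
        abel)
      map_smul' := fun k s => Subtype.ext (by
        simp only [Prod.smul_fst, Prod.smul_snd, p.diag_smul, Submodule.coe_smul,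
          Subalgebra.coe_smul, smul_mul_assoc, SetLike.val_smul, smul_add, RingHom.id_apply]) }
  have hf : Function.Bijective f := by
    constructor
    · intro s t hst
      have h : p.diag s.1 + s.2.1 * u + s.2.2 * v = p.diag t.1 + t.2.1 * u + t.2.2 * v :=
        congrArg Subtype.val hst
      have e : ∀ t : p.core × H × H, p.diag t.1 + t.2.1 * u + t.2.2 * v =
          p.ofComp t.1 t.2.1 t.2.2 (-p.coreInvolution t.1) := fun t => by
        simp only [diag, ofComp, NegMemClass.coe_neg, neg_mul]; abel
      rw [e, e] at h
      have h1 := p.comp_ofComp s.1 s.2.1 s.2.2 (-p.coreInvolution s.1)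
      have h2 := p.comp_ofComp t.1 t.2.1 t.2.2 (-p.coreInvolution t.1)
      rw [h] at h1
      exact Prod.ext (h1.1.symm.trans h2.1) (Prod.ext (Subtype.ext (h1.2.1.symm.trans h2.2.1))
        (Subtype.ext (h1.2.2.1.symm.trans h2.2.2.1)))
    · rintro ⟨x, hx⟩
      obtain ⟨a, b, c, hb, hc, rfl⟩ := p.exists_of_skew hx
      exact ⟨(a, ⟨b, hb⟩, ⟨c, hc⟩), rfl⟩
  rw [← (LinearEquiv.ofBijective f hf).finrank_eq, finrank_prod, finrank_prod]
  ring

end IsHyperbolicPair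

/-! ### Central simple algebras with involution over an algebraically closed field -/

section CentralSimple

variable {F R : Type*} [Field F] [Ring R] [Algebra F R]

section Density

theorem mulLeftRight_smul (a b x : R) :
    (⟨_, a ⊗ₜ MulOpposite.op b, rfl⟩ : (AlgHom.mulLeftRight F R).range) • x = a * x * b :=
  AlgHom.mulLeftRight_apply F R a (MulOpposite.op b) x

variable [IsSimpleRing R]

/-- Submodules for left and right multiplications are two-sided ideals. -/
theorem isSimpleModule_mulLeftRight : IsSimpleModule (AlgHom.mulLeftRight F R).range R := by
  rw [isSimpleModule_iff]
  refine { exists_pair_ne := ⟨⊥, ⊤, bot_ne_top⟩, eq_bot_or_eq_top := fun N => ?_ }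
  by_cases hN : N = ⊥
  · exact Or.inl hN
  · right
    obtain ⟨u, hu, h0⟩ := N.exists_mem_ne_zero_of_ne_bot hN
    have key : ∀ a b : R, ∀ y ∈ N, a * y * b ∈ N := fun a b y hy => by
      rw [← mulLeftRight_smul (F := F)]
      exact N.smul_mem _ hy
    rw [eq_top_iff]
    intro x _
    let U : AddSubgroup R :=
      { carrier := N
        add_mem' := fun h h' => N.add_mem h h'
        zero_mem' := N.zero_mem
        neg_mem' := fun {y} h => by simpa using key (-1) 1 y h }
    exact IsSimpleRing.mem_of_absorbing U
      (fun x y (hy : y ∈ N) => show x * y ∈ N by simpa using key x 1 y hy)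
      (fun x y (hy : y ∈ N) => show y * x ∈ N by simpa using key 1 x y hy) hu h0 x

/-- The linear endomorphisms of a central simple algebra are generated by left and right
multiplications. -/
theorem mulLeftRight_surjective [Algebra.IsCentral F R] [FiniteDimensional F R] (f : End F R) :
    ∃ t, AlgHom.mulLeftRight F R t = f := by
  classical
  have := isSimpleModule_mulLeftRight (F := F) (R := R)
  -- A bimodule endomorphism is multiplication by its value at $1$, which is central, hence a
  -- scalar. Every $F$-linear map then commutes with it, and the density theorem on a basis applies.
  have hE : ∀ e : End (AlgHom.mulLeftRight F R).range R, ∃ c : F, ∀ x, e x = c • x := fun e => by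
    have key : ∀ a b x : R, e (a * x * b) = a * e x * b := fun a b x => by
      rw [← mulLeftRight_smul (F := F), map_smul, mulLeftRight_smul]
    have hl : ∀ a, e a = a * e 1 := fun a => by simpa using key a 1 1
    have hr : ∀ a, e a = e 1 * a := fun a => by simpa using key 1 a 1
    have hc : e 1 ∈ Subalgebra.center F R :=
      Subalgebra.mem_center_iff.2 fun a => by rw [← hl, ← hr]
    obtain ⟨c, hc⟩ := Algebra.mem_bot.1 (Algebra.IsCentral.out hc)
    exact ⟨c, fun x => by rw [hr, ← hc, Algebra.smul_def]⟩
  let f' : End (End (AlgHom.mulLeftRight F R).range R) R :=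
    { toFun := f
      map_add' := map_add f
      map_smul' := fun e x => by
        obtain ⟨c, hc⟩ := hE e
        simp only [RingHom.id_apply, End.smul_def]
        rw [hc, hc, map_smul] }
  let b := Module.finBasis F R
  obtain ⟨⟨_, t, rfl⟩, hr⟩ := jacobson_density
    (R := (AlgHom.mulLeftRight F R).range) (M := R) f' (Finset.univ.image b)
  exact ⟨t, b.ext fun i => (hr (b i) (Finset.mem_image_of_mem _ (Finset.mem_univ i))).symm⟩

/-- A central simple algebra stays simple after an extension of scalars. -/
theorem isSimpleRing_baseChange [Algebra.IsCentral F R] [FiniteDimensional F R] (L : Type*) [Field L] [Algebra F L] :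
    IsSimpleRing (L ⊗[F] R) := by
  let b := Module.finBasis F R
  let b' := Algebra.TensorProduct.basis L b
  have : Nontrivial (L ⊗[F] R) := by
    have : Nontrivial (Fin (finrank F R) →₀ L) := by
      have : Nonempty (Fin (finrank F R)) := ⟨⟨0, finrank_pos⟩⟩
      infer_instance
    exact b'.repr.symm.injective.nontrivial
  refine ⟨{ exists_pair_ne := ⟨⊥, ⊤, bot_ne_top⟩, eq_bot_or_eq_top := fun I => ?_ }⟩
  by_cases hI : ∀ x ∈ I, x = 0
  · exact Or.inl (le_antisymm (fun x hx => (TwoSidedIdeal.mem_bot _).2 (hI x hx)) bot_le)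
  right
  push Not at hI
  obtain ⟨x, hx, h0⟩ := hI
  -- Since $f$ is a combination of maps $y\mapsto pyq$, the ideal is stable under
  -- $\mathrm{id}_L\otimes f$.
  have key : ∀ f : End F R, f.baseChange L x ∈ I := fun f => by
    obtain ⟨t, rfl⟩ := mulLeftRight_surjective f
    induction t using TensorProduct.induction_on with
    | zero => simp
    | add s t hs ht =>
      rw [map_add, LinearMap.baseChange_add]
      exact I.add_mem hs ht
    | tmul p q =>
      have e : ∀ y : L ⊗[F] R, (AlgHom.mulLeftRight F R (p ⊗ₜ q)).baseChange L y =
          (1 ⊗ₜ p) * y * (1 ⊗ₜ q.unop) := fun y => by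
        induction y using TensorProduct.induction_on with
        | zero => simp
        | add y z hy hz => rw [map_add, hy, hz, mul_add, add_mul]
        | tmul l r => simp
      rw [e]
      exact I.mul_mem_right _ _ (I.mul_mem_left _ _ hx)
  obtain ⟨i, hi⟩ : ∃ i, b'.repr x i ≠ 0 := by
    by_contra! h
    exact h0 (b'.repr.map_eq_zero_iff.1 (Finsupp.ext h))
  -- The map $f=b_i^*(\cdot)\,1$ moves $x$ to its nonzero $i$-th coordinate in $L\otimes1$, which is
  -- invertible.
  have e : ∀ y : L ⊗[F] R, ((b.coord i).smulRight (1 : R)).baseChange L y =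
      (b'.repr y i) ⊗ₜ 1 := fun y => by
    induction y using TensorProduct.induction_on with
    | zero => simp
    | add y z hy hz => rw [map_add, hy, hz, map_add, Finsupp.add_apply, TensorProduct.add_tmul]
    | tmul l r =>
      simp only [LinearMap.baseChange_tmul, LinearMap.smulRight_apply, Basis.coord_apply, b',
        Algebra.TensorProduct.basis_repr_tmul, Finsupp.smul_apply, Finsupp.mapRange_apply,
        smul_eq_mul]
      rw [← TensorProduct.smul_tmul, Algebra.smul_def, mul_comm]
  have h1 := key ((b.coord i).smulRight (1 : R))
  rw [e] at h1
  have h2 := I.mul_mem_left ((b'.repr x i)⁻¹ ⊗ₜ 1) _ h1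
  rw [Algebra.TensorProduct.tmul_mul_tmul, inv_mul_cancel₀ hi, one_mul] at h2
  exact (TwoSidedIdeal.one_mem_iff I).1 h2

end Density

/-- Automorphisms of matrix algebras are inner. -/
theorem exists_conj_of_algEquiv {L : Type*} [Field L] {d : ℕ}
    (α : Matrix (Fin d) (Fin d) L ≃ₐ[L] Matrix (Fin d) (Fin d) L) :
    ∃ h : Matrix (Fin d) (Fin d) L, IsUnit h.det ∧ ∀ M, α M * h = h * M := by
  let β := (Matrix.toLinAlgEquiv' (R := L) (n := Fin d))
  obtain ⟨T, hT⟩ := ((β.symm.trans α).trans β).eq_linearEquivConjAlgEquiv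
  refine ⟨β.symm T.toLinearMap, ?_, fun M => ?_⟩
  · rw [← Matrix.isUnit_iff_isUnit_det]
    exact ((LinearMap.isUnit_iff_isUnit_det _).2 T.isUnit_det').map β.symm
  · apply β.injective
    have h1 : β (α M) = T.conjAlgEquiv L (β M) := by
      rw [← hT]; simp
    rw [map_mul, map_mul, h1, β.apply_symm_apply]
    refine LinearMap.ext fun x => ?_
    simp [LinearEquiv.conjAlgEquiv_apply]

/-- Over an algebraically closed field, an involution of the first kind is adjoint to a symmetric
or a skew-symmetric matrix. -/
theorem exists_matrix_adjoint [IsSimpleRing R] [Algebra.IsCentral F R] [FiniteDimensional F R]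
    (L : Type*) [Field L] [Algebra F L] [IsAlgClosed L] (σ : AlgInvolution F R) :
    ∃ (d : ℕ) (φ : L ⊗[F] R ≃ₐ[L] Matrix (Fin d) (Fin d) L) (g : Matrix (Fin d) (Fin d) L),
      IsUnit g.det ∧ (g.transpose = g ∨ g.transpose = -g) ∧
        ∀ x : R, φ (1 ⊗ₜ σ x) = g⁻¹ * (φ (1 ⊗ₜ x)).transpose * g := by
  have := isSimpleRing_baseChange (F := F) (R := R) L
  obtain ⟨d, hd, ⟨φ⟩⟩ := IsSimpleRing.exists_algEquiv_matrix_of_isAlgClosed L (L ⊗[F] R)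
  -- Transposition and $\sigma$ both reverse products, so their composite is a homomorphism.
  -- Extended to $L\otimes R$ it is an automorphism of the matrix algebra, hence conjugation by some
  -- $h$; the required Gram matrix is $h^{T}$.
  let ψ : R →ₐ[F] Matrix (Fin d) (Fin d) L := AlgHom.ofLinearMap
    { toFun := fun x => (φ (1 ⊗ₜ σ x)).transpose
      map_add' := fun x y => by
        rw [map_add, TensorProduct.tmul_add, map_add, Matrix.transpose_add]
      map_smul' := fun c x => by
        rw [map_smul, TensorProduct.tmul_smul, ← algebraMap_smul L c, map_smul,
          Matrix.transpose_smul, algebraMap_smul, RingHom.id_apply] }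
    (by
      have h : φ (1 ⊗ₜ σ 1) = 1 := by
        rw [σ.apply_one, ← Algebra.TensorProduct.one_def, map_one]
      simp [h])
    (fun x y => by
      simp only [LinearMap.coe_mk, AddHom.coe_mk]
      rw [← Matrix.transpose_mul, ← map_mul, Algebra.TensorProduct.tmul_mul_tmul, one_mul,
        σ.map_mul_rev])
  let Ψ : L ⊗[F] R →ₐ[L] Matrix (Fin d) (Fin d) L :=
    Algebra.TensorProduct.lift (Algebra.ofId L _) ψ fun l x => Algebra.commutes l (ψ x)
  have hΨ : ∀ x : R, Ψ (1 ⊗ₜ x) = (φ (1 ⊗ₜ σ x)).transpose := fun x => by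
    have := Algebra.TensorProduct.lift_tmul (Algebra.ofId L (Matrix (Fin d) (Fin d) L)) ψ
      (fun l x => Algebra.commutes l (ψ x)) 1 x
    rw [map_one, one_mul] at this
    exact this
  obtain ⟨h, hh, hα⟩ := exists_conj_of_algEquiv
    (AlgEquiv.ofBijective (Ψ.comp φ.symm.toAlgHom) (AlgHom.bijective _))
  have h1 : ∀ x : R, (φ (1 ⊗ₜ σ x)).transpose * h = h * φ (1 ⊗ₜ x) := fun x => by
    have := hα (φ (1 ⊗ₜ x))
    rw [← hΨ]
    simpa using this
  have hdet : IsUnit h.transpose.det := by rwa [Matrix.det_transpose]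
  have h2 : ∀ x : R, h.transpose * φ (1 ⊗ₜ σ x) = (φ (1 ⊗ₜ x)).transpose * h.transpose :=
    fun x => by
      have := congrArg Matrix.transpose (h1 x)
      simpa only [Matrix.transpose_mul, Matrix.transpose_transpose] using this
  refine ⟨d, φ, h.transpose, hdet, ?_, fun x => ?_⟩
  swap
  · rw [mul_assoc, ← h2, Matrix.nonsing_inv_mul_cancel_left _ _ hdet]
  -- Applying the relation to $x$ and to $\sigma(x)$, with $\sigma^2=1$, shows that $h^{-1}h^{T}$ is
  -- central. So $h^{T}=ch$, and transposing twice gives $c^2=1$.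
  have h3 : ∀ x : R, h⁻¹ * h.transpose * φ (1 ⊗ₜ x) = φ (1 ⊗ₜ x) * (h⁻¹ * h.transpose) :=
    fun x => by
      have e1 := h2 (σ x)
      rw [σ.apply_apply] at e1
      have e2 := h1 x
      have e3 : (φ (1 ⊗ₜ σ x)).transpose = h * φ (1 ⊗ₜ x) * h⁻¹ := by
        rw [← e2, Matrix.mul_nonsing_inv_cancel_right _ _ hh]
      rw [mul_assoc, e1, e3]
      simp only [← mul_assoc]
      rw [Matrix.nonsing_inv_mul _ hh, one_mul]
  have h4 : ∀ y : L ⊗[F] R, h⁻¹ * h.transpose * φ y = φ y * (h⁻¹ * h.transpose) := fun y => by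
    induction y using TensorProduct.induction_on with
    | zero => simp
    | add y z hy hz => rw [map_add, mul_add, add_mul, hy, hz]
    | tmul l x =>
      have e : l ⊗ₜ[F] x = l • ((1 : L) ⊗ₜ[F] x) := by
        rw [TensorProduct.smul_tmul', smul_eq_mul, mul_one]
      rw [e, map_smul, mul_smul_comm, smul_mul_assoc, h3]
  obtain ⟨c, hc⟩ : h⁻¹ * h.transpose ∈ Set.range (Matrix.scalar (Fin d)) :=
    Matrix.mem_range_scalar_of_commute_single fun i j _ => by
      have := h4 (φ.symm (Matrix.single i j 1))
      rw [φ.apply_symm_apply] at this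
      exact this.symm
  have h5 : h.transpose = c • h := by
    have e : h * (h⁻¹ * h.transpose) = h.transpose := by
      rw [← mul_assoc, Matrix.mul_nonsing_inv _ hh, one_mul]
    rw [← e, ← hc, Matrix.scalar_apply, ← Matrix.smul_one_eq_diagonal, mul_smul_comm, mul_one]
  have h6 : h = (c * c) • h := by
    have e := congrArg Matrix.transpose h5
    rw [Matrix.transpose_transpose, Matrix.transpose_smul, h5, smul_smul] at e
    exact e
  have h7 : c * c = 1 := by
    have hne : h ≠ 0 := fun h0 => by
      rw [h0, Matrix.det_zero] at hh
      exact not_isUnit_zero hh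
    have e : (c * c - 1) • h = 0 := by rw [sub_smul, one_smul, ← h6, sub_self]
    exact sub_eq_zero.1 ((smul_eq_zero_iff_left hne).1 e)
  rcases mul_self_eq_one_iff.1 h7 with rfl | rfl
  · left; rw [Matrix.transpose_transpose, h5, one_smul]
  · right; rw [Matrix.transpose_transpose, h5]; simp

/-- The coefficient of $E_{ij}$ in $g^{-1}E_{ji}\,g$ is $(g^{-1})_{ij}g_{ij}$, so the trace is
$\operatorname{tr}(g^{-1}g^{T})=\varepsilon d$. -/
theorem trace_adjoint {L : Type*} [Field L] {d : ℕ} (g : Matrix (Fin d) (Fin d) L)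
    (hg : IsUnit g.det) {ε : L} (hε : g.transpose = ε • g)
    (T : Matrix (Fin d) (Fin d) L →ₗ[L] Matrix (Fin d) (Fin d) L)
    (hT : ∀ M, T M = g⁻¹ * M.transpose * g) : LinearMap.trace L _ T = ε * d := by
  classical
  rw [LinearMap.trace_eq_matrix_trace L (Matrix.stdBasis L (Fin d) (Fin d)), Matrix.trace]
  have h1 : ∀ i j, (LinearMap.toMatrix (Matrix.stdBasis L (Fin d) (Fin d))
      (Matrix.stdBasis L (Fin d) (Fin d)) T).diag (i, j) = g⁻¹ i j * g.transpose j i := by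
    intro i j
    rw [Matrix.diag_apply, LinearMap.toMatrix_apply, Matrix.stdBasis_eq_single, hT,
      Matrix.transpose_single]
    change (g⁻¹ * Matrix.single j i (1 : L) * g : Matrix (Fin d) (Fin d) L) i j = _
    rw [Matrix.mul_apply, Finset.sum_eq_single i]
    · simp
    · intro k _ hk
      rw [Matrix.mul_single_apply_of_ne _ _ _ _ _ hk, zero_mul]
    · simp
  rw [Fintype.sum_prod_type]
  simp only [h1]
  have h2 : ∀ i, ∑ j, g⁻¹ i j * g.transpose j i = (ε • (1 : Matrix (Fin d) (Fin d) L)) i i := by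
    intro i
    rw [← Matrix.mul_apply, hε, mul_smul_comm, Matrix.nonsing_inv_mul _ hg]
  simp only [h2]
  simp [mul_comm]

/-- The trace of an involution that is adjoint to a symmetric or skew-symmetric matrix. -/
theorem trace_involution [FiniteDimensional F R] {L : Type*} [Field L] [Algebra F L]
    (σ : AlgInvolution F R) {d : ℕ} (φ : L ⊗[F] R ≃ₐ[L] Matrix (Fin d) (Fin d) L)
    (g : Matrix (Fin d) (Fin d) L) (hg : IsUnit g.det) {ε : L} (hε : g.transpose = ε • g)
    (hφ : ∀ x : R, φ (1 ⊗ₜ σ x) = g⁻¹ * (φ (1 ⊗ₜ x)).transpose * g) :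
    algebraMap F L (LinearMap.trace F R σ.toLinearMap) = ε * d := by
  rw [← LinearMap.trace_baseChange, ← LinearMap.trace_conj' _ φ.toLinearEquiv]
  refine trace_adjoint g hg hε _ fun M => ?_
  obtain ⟨y, rfl⟩ := φ.surjective M
  have h : φ (σ.toLinearMap.baseChange L y) = g⁻¹ * (φ y).transpose * g := by
    induction y using TensorProduct.induction_on with
    | zero => simp
    | add y z hy hz =>
      rw [map_add, map_add, hy, hz, map_add, Matrix.transpose_add, mul_add, add_mul]
    | tmul l x =>
      have e : ∀ x : R, l ⊗ₜ[F] x = l • ((1 : L) ⊗ₜ[F] x) := fun x => by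
        rw [TensorProduct.smul_tmul', smul_eq_mul, mul_one]
      rw [LinearMap.baseChange_tmul, e, e, map_smul, map_smul, Matrix.transpose_smul, hφ,
        mul_smul_comm, smul_mul_assoc]
  rw [← h]
  simp [LinearEquiv.conj_apply]

/-- The trace of an involution in terms of dimensions. -/
theorem trace_involution_eq [CharZero F] [FiniteDimensional F R] (σ : AlgInvolution F R) :
    LinearMap.trace F R σ.toLinearMap = finrank F R - 2 * finrank F σ.skew := by
  -- $(1-\sigma)/2$ projects onto the skew elements; its trace is their dimension.
  have h : LinearMap.IsProj σ.skew.toSubmodule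
      ((2 : F)⁻¹ • (LinearMap.id - σ.toLinearMap)) := by
    refine ⟨fun x => ?_, fun x hx => ?_⟩
    · refine Submodule.smul_mem _ _ ?_
      exact AlgInvolution.apply_sub_apply x
    · have hx' : σ x = -x := hx
      simp [hx', ← two_smul F x]
  have h1 := h.trace
  rw [map_smul, map_sub, LinearMap.trace_id, smul_eq_mul] at h1
  have h2 : (finrank F σ.skew.toSubmodule : F) = finrank F σ.skew := rfl
  rw [h2] at h1
  rw [← h1]
  ring

theorem finrank_eq_mul_self [FiniteDimensional F R] {L : Type*} [Field L] [Algebra F L] {d : ℕ}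
    (φ : L ⊗[F] R ≃ₐ[L] Matrix (Fin d) (Fin d) L) : finrank F R = d * d := by
  rw [← Module.finrank_baseChange (R := L), φ.toLinearEquiv.finrank_eq, finrank_matrix]
  simp

namespace IsHyperbolicPair

variable [CharZero F] [FiniteDimensional F R] {σ : AlgInvolution F R} {u v : R}
  (p : IsHyperbolicPair σ u v)

-- With $N$ and $h$ the two dimensions on the right, $\dim R=4N$ and the skew part has dimension
-- $N+2h$, so the trace is $4N-2(N+2h)$.
include p in
theorem trace_eq_finrank_core : LinearMap.trace F R σ.toLinearMap = 2 * finrank F p.core -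
    4 * finrank F (LinearMap.eqLocus p.coreInvolution.toLinearMap LinearMap.id) := by
  rw [trace_involution_eq, p.finrank_skew, p.finrank_eq]
  push_cast
  ring

/-- If an algebra with a hyperbolic pair has degree `4` and an orthogonal involution, the symmetric
elements of the centralizer of the pair form a line. -/
theorem finrank_sym_eq_one {L : Type*} [Field L] [Algebra F L]
    (φ : L ⊗[F] R ≃ₐ[L] Matrix (Fin 4) (Fin 4) L) (g : Matrix (Fin 4) (Fin 4) L)
    (hg : IsUnit g.det) (hs : g.transpose = g)
    (hφ : ∀ x : R, φ (1 ⊗ₜ σ x) = g⁻¹ * (φ (1 ⊗ₜ x)).transpose * g) :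
    finrank F (LinearMap.eqLocus p.coreInvolution.toLinearMap LinearMap.id) = 1 := by
  have h1 := trace_involution σ φ g hg (ε := 1) (by rw [hs, one_smul]) hφ
  have h2 := finrank_eq_mul_self φ
  rw [p.finrank_eq] at h2
  -- $4N=4^2$ gives $N=4$; then the trace $8-4h$ equals $4$.
  have h3 : finrank F p.core = 4 := by omega
  rw [p.trace_eq_finrank_core, h3] at h1
  have h4 : LinearMap.trace F R σ.toLinearMap = 4 := by
    rw [p.trace_eq_finrank_core, h3]
    apply (algebraMap F L).injective
    rw [h1, map_ofNat]; simp
  rw [p.trace_eq_finrank_core, h3] at h4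
  have h5 : (4 : F) * finrank F (LinearMap.eqLocus p.coreInvolution.toLinearMap LinearMap.id) = 4 := by
    push_cast at h4
    linear_combination -h4
  have h6 : 4 * finrank F (LinearMap.eqLocus p.coreInvolution.toLinearMap LinearMap.id) = 4 := by
    exact_mod_cast h5
  omega

/-- If the symmetric elements of the centralizer of a hyperbolic pair form a line, and the
centralizer is not commutative, then the algebra has degree `4` and its involution is orthogonal. -/
theorem orthogonal_of_finrank_sym_eq_one [IsSimpleRing R] [Algebra.IsCentral F R]
    (h1 : finrank F (LinearMap.eqLocus p.coreInvolution.toLinearMap LinearMap.id) = 1)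
    (hN : finrank F p.core ≠ 1) (L : Type*) [Field L] [Algebra F L] [IsAlgClosed L] :
    ∃ (φ : L ⊗[F] R ≃ₐ[L] Matrix (Fin 4) (Fin 4) L) (g : Matrix (Fin 4) (Fin 4) L),
      IsUnit g.det ∧ g.transpose = g ∧
        ∀ x : R, φ (1 ⊗ₜ σ x) = g⁻¹ * (φ (1 ⊗ₜ x)).transpose * g := by
  obtain ⟨d, φ, g, hg, hs, hφ⟩ := exists_matrix_adjoint L σ
  have : CharZero L := charZero_of_injective_algebraMap (algebraMap F L).injective
  have hd := finrank_eq_mul_self φ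
  rw [p.finrank_eq] at hd
  have hpos : 0 < finrank F R := finrank_pos
  rw [p.finrank_eq] at hpos
  rcases hs with hs | hs
  · have h2 := trace_involution σ φ g hg (ε := 1) (by rw [hs, one_smul]) hφ
    rw [p.trace_eq_finrank_core, h1] at h2
    have h3 : (2 * finrank F p.core : ℤ) - 4 = d := by
      have : (((2 * finrank F p.core : ℤ) - 4 : ℤ) : L) = ((d : ℤ) : L) := by
        push_cast
        simpa only [map_sub, map_mul, map_ofNat, map_natCast, Nat.cast_one, mul_one, one_mul,
          neg_one_mul] using h2
      exact_mod_cast this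
    -- $2N-4=d$ and $d^2=4N$ combine to $(d-4)(d+2)=0$.
    have h4 : d = 4 := by
      zify at hd
      have h5 : ((d : ℤ) - 4) * (d + 2) = 0 := by linear_combination -hd + 2 * h3
      rcases mul_eq_zero.1 h5 with h6 | h6 <;> omega
    subst h4
    exact ⟨φ, g, hg, hs, hφ⟩
  -- In the skew-symmetric case the equation is $(d+4)(d-2)=0$. Then $d=2$ and the centralizer has
  -- dimension $1$, contrary to `hN`.
  · exfalso
    have h2 := trace_involution σ φ g hg (ε := -1) (by rw [hs, neg_one_smul]) hφ
    rw [p.trace_eq_finrank_core, h1] at h2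
    have h3 : (2 * finrank F p.core : ℤ) - 4 = -d := by
      have : (((2 * finrank F p.core : ℤ) - 4 : ℤ) : L) = ((-d : ℤ) : L) := by
        push_cast
        simpa only [map_sub, map_mul, map_ofNat, map_natCast, Nat.cast_one, mul_one, one_mul,
          neg_one_mul] using h2
      exact_mod_cast this
    have h4 : d = 2 := by
      zify at hd
      have h5 : ((d : ℤ) + 4) * (d - 2) = 0 := by linear_combination -hd + 2 * h3
      rcases mul_eq_zero.1 h5 with h6 | h6 <;> omega
    subst h4
    omega

end IsHyperbolicPair

end CentralSimple

/-! ### The symplectic form attached to a Lefschetz element -/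

section Lefschetz

variable {K : Type*} [Field K] {V : Type*} [AddCommGroup V] [Module K V]

/-- The contraction of the exterior algebra by a linear form. -/
noncomputable def extContract :
    Dual K V →ₗ[K] ExteriorAlgebra K V →ₗ[K] ExteriorAlgebra K V :=
  CliffordAlgebra.contractLeft

theorem extContract_ι_mul (η : Dual K V) (v : V) (x : ExteriorAlgebra K V) :
    extContract η (ExteriorAlgebra.ι K v * x) =
      η v • x - ExteriorAlgebra.ι K v * extContract η x :=
  CliffordAlgebra.contractLeft_ι_mul η v x

theorem extContract_one (η : Dual K V) : extContract η (1 : ExteriorAlgebra K V) = 0 :=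
  CliffordAlgebra.contractLeft_one _ η

theorem extContract_ι (η : Dual K V) (v : V) :
    extContract η (ExteriorAlgebra.ι K v) = algebraMap K _ (η v) :=
  CliffordAlgebra.contractLeft_ι _ η v

/-- Naturality of contraction: this turns the invariance of the Lefschetz element into equivariance
of $\eta\mapsto\eta\lrcorner a$. -/
theorem map_extContract (f : V →ₗ[K] V) (η : Dual K V) (x : ExteriorAlgebra K V) :
    ExteriorAlgebra.map f (extContract (η ∘ₗ f) x) = extContract η (ExteriorAlgebra.map f x) := by
  induction x using CliffordAlgebra.left_induction with
  | algebraMap r =>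
    have e1 : ∀ η : Dual K V, extContract η (algebraMap K (ExteriorAlgebra K V) r) = 0 := fun η => by
      rw [Algebra.algebraMap_eq_smul_one, map_smul, extContract_one, smul_zero]
    change ExteriorAlgebra.map f (extContract (η ∘ₗ f) (algebraMap K (ExteriorAlgebra K V) r)) =
      extContract η (ExteriorAlgebra.map f (algebraMap K (ExteriorAlgebra K V) r))
    rw [AlgHom.commutes, e1, e1, map_zero]
  | add x y hx hy => simp only [map_add, hx, hy]
  | ι_mul x v hx =>
    have e1 := extContract_ι_mul (η ∘ₗ f) v x
    have e2 := extContract_ι_mul η (f v) (ExteriorAlgebra.map f x)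
    have e3 : ExteriorAlgebra.map f (ExteriorAlgebra.ι K v * x) =
      ExteriorAlgebra.ι K (f v) * ExteriorAlgebra.map f x := by
      rw [map_mul, ExteriorAlgebra.map_apply_ι]
    change ExteriorAlgebra.map f (extContract (η ∘ₗ f) (ExteriorAlgebra.ι K v * x)) =
      extContract η (ExteriorAlgebra.map f (ExteriorAlgebra.ι K v * x))
    rw [e1, e3, e2, map_sub, map_smul, map_mul, hx, ExteriorAlgebra.map_apply_ι]
    rfl

theorem ext_two_induction {P : ExteriorAlgebra K V → Prop} {a : ExteriorAlgebra K V}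
    (ha : a ∈ ⋀[K]^2 V)
    (hι : ∀ v w, P (ExteriorAlgebra.ι K v * ExteriorAlgebra.ι K w))
    (hadd : ∀ x y, P x → P y → P (x + y)) : P a := by
  rw [ExteriorAlgebra.exteriorPower, pow_two] at ha
  induction ha using Submodule.mul_induction_on' with
  | mem_mul_mem x hx y hy =>
    obtain ⟨v, rfl⟩ := hx
    obtain ⟨w, rfl⟩ := hy
    exact hι v w
  | add x _ y _ hx hy => exact hadd x y hx hy

/-- Contraction is an antiderivation, and no sign appears because $a$ has even degree. -/
theorem extContract_mul {a : ExteriorAlgebra K V} (ha : a ∈ ⋀[K]^2 V) (η : Dual K V)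
    (x : ExteriorAlgebra K V) :
    extContract η (a * x) = extContract η a * x + a * extContract η x := by
  refine ext_two_induction
    (P := fun a => extContract η (a * x) = extContract η a * x + a * extContract η x) ha (fun v w => ?_) (fun a b h h' => ?_)
  · rw [mul_assoc, extContract_ι_mul, extContract_ι_mul, extContract_ι_mul, extContract_ι,
      ← Algebra.commutes, ← Algebra.smul_def, sub_mul, smul_mul_assoc, smul_mul_assoc, mul_sub,
      mul_smul_comm, mul_assoc]
    abel
  · rw [add_mul, map_add, map_add, h, h', add_mul, add_mul]
    abel

theorem ι_ιInv_extContract {a : ExteriorAlgebra K V} (ha : a ∈ ⋀[K]^2 V) (η : Dual K V) :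
    ExteriorAlgebra.ι K (ExteriorAlgebra.ιInv (extContract η a)) = extContract η a := by
  refine ext_two_induction (P := fun a =>
    ExteriorAlgebra.ι K (ExteriorAlgebra.ιInv (extContract η a)) = extContract η a) ha
    (fun v w => ?_) (fun a b h h' => ?_)
  · rw [extContract_ι_mul, extContract_ι, ← Algebra.commutes, ← Algebra.smul_def, ← map_smul,
      ← map_smul, ← map_sub, ExteriorAlgebra.ι_leftInverse]
  · rw [map_add, map_add, map_add, h, h']

/-- A Lefschetz element is non-degenerate. -/
theorem HardLefschetz.eq_zero_of_extContract {n : ℕ} {a : ExteriorAlgebra K V}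
    (h : HardLefschetz (fun k => ⋀[K]^k V) n a) {η : Dual K V} (hη : extContract η a = 0) :
    η = 0 := by
  by_contra hne
  obtain ⟨w, hw⟩ : ∃ w, η w ≠ 0 := by
    by_contra! h'
    exact hne (LinearMap.ext h')
  -- By the Leibniz rule, a form that contracts $a$ to zero does the same to every power of $a$.
  have h1 : ∀ k, extContract η (a ^ k) = 0 := fun k => by
    induction k with
    | zero => rw [pow_zero, extContract_one]
    | succ k ih => rw [pow_succ', extContract_mul h.mem, hη, ih, zero_mul, mul_zero, add_zero]
  have hb := h.bijOn n le_rfl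
  rw [Nat.sub_self, ← two_mul] at hb
  have h0 : (1 : ExteriorAlgebra K V) ∈ ⋀[K]^0 V := by
    rw [ExteriorAlgebra.exteriorPower, pow_zero]; exact Submodule.one_le.1 le_rfl
  have hmem : a ^ n ∈ ⋀[K]^(2 * n) V := by simpa using hb.mapsTo h0
  -- $w\wedge a^n$ has degree $2n+1$, beyond the top. Contracting it gives $\eta(w)a^n=0$, so
  -- $a^n=0$; but the top degree is $a^n\cdot R_0\ne0$.
  have hzero : ExteriorAlgebra.ι K w * a ^ n = 0 := by
    have e := h.eq_bot (2 * n + 1) (Nat.lt_succ_self _)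
    have : ExteriorAlgebra.ι K w * a ^ n ∈ ⋀[K]^(2 * n + 1) V := by
      rw [ExteriorAlgebra.exteriorPower, pow_succ']
      exact Submodule.mul_mem_mul (LinearMap.mem_range_self _ w) hmem
    rw [← Submodule.mem_bot K, ← e]
    exact this
  have h2 := extContract_ι_mul η w (a ^ n)
  rw [hzero, map_zero, h1, mul_zero, sub_zero] at h2
  have h3 : a ^ n = 0 := (smul_eq_zero_iff_right hw).1 h2.symm
  refine h.top_ne ((Submodule.eq_bot_iff _).2 fun x hx => ?_)
  obtain ⟨y, _, rfl⟩ := hb.surjOn hx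
  simp [h3]

/-- An invariant Lefschetz element gives an equivariant alternating isomorphism `V* ≃ V`. -/
theorem HardLefschetz.exists_symplectic [FiniteDimensional K V] {G : Type*} [Group G]
    {π : Representation K G V} {n : ℕ} {a : ExteriorAlgebra K V}
    (h : HardLefschetz (fun k => ⋀[K]^k V) n a) (ha : a ∈ extInvariants π 2) :
    ∃ J : Dual K V ≃ₗ[K] V, (∀ η θ : Dual K V, η (J θ) = -θ (J η)) ∧ ∀ g η, π g (J η) = J (π.dual g η) := by
  let J₀ : Dual K V →ₗ[K] V := ExteriorAlgebra.ιInv ∘ₗ extContract.flip a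
  have hJ : ∀ η, ExteriorAlgebra.ι K (J₀ η) = extContract η a := fun η =>
    ι_ιInv_extContract h.mem η
  have hinj : Function.Injective J₀ := by
    rw [← LinearMap.ker_eq_bot, LinearMap.ker_eq_bot']
    intro η hη
    refine h.eq_zero_of_extContract ?_
    rw [← hJ, hη, map_zero]
  refine ⟨LinearEquiv.ofInjectiveOfFinrankEq J₀ hinj Subspace.dual_finrank_eq,
    fun η θ => ?_, fun g η => ?_⟩
  · change η (J₀ θ) = -θ (J₀ η)
    apply (ExteriorAlgebra.algebraMap_inj V _ _).1
    rw [map_neg, ← extContract_ι, ← extContract_ι, hJ, hJ]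
    -- Contractions by two forms anticommute: this is the alternation of $J$.
    exact CliffordAlgebra.contractLeft_comm η θ a
  · change π g (J₀ η) = J₀ (π.dual g η)
    apply (ExteriorAlgebra.ι_inj (R := K) _ _).1
    have hinv : ExteriorAlgebra.map (π g) a = a := by
      have := (Submodule.mem_iInf _).1 ha.2 g
      exact this
    have e : π.dual g η ∘ₗ π g = η := by
      ext v
      simp [Dual.transpose_apply]
    have := map_extContract (π g) (π.dual g η) a
    rw [e, hinv] at this
    rw [← ExteriorAlgebra.map_apply_ι, hJ, hJ, this]

end Lefschetz

/-! ### Commutants -/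

section Commutant

variable {K A M : Type*} [Field K] [Ring A] [Algebra K A] [AddCommGroup M] [Module K M]

/-- The double commutant theorem for a semisimple algebra. -/
theorem exists_of_mem_double_commutant [IsSemisimpleRing A] [FiniteDimensional K M]
    (α : A →ₐ[K] End K M) (z : End K M)
    (hz : ∀ f : End K M, (∀ a, α a * f = f * α a) → z * f = f * z) : ∃ a, α a = z := by
  classical
  let : Module A M := Module.compHom M α.toRingHom
  have hs : ∀ (a : A) (m : M), a • m = α a m := fun _ _ => rfl
  -- Commuting with the commutant means being linear over $\operatorname{End}_A(M)$, so density
  -- realizes $z$ on a finite basis by an element of $A$.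
  let z' : End (End A M) M :=
    { toFun := z
      map_add' := map_add z
      map_smul' := fun e m => by
        let f : End K M :=
          { toFun := e
            map_add' := map_add e
            map_smul' := fun k m => by
              have h : ∀ m : M, k • m = (algebraMap K A k) • m := fun m => by
                rw [hs, AlgHom.commutes, Module.algebraMap_end_apply]
              rw [h, map_smul, ← h, RingHom.id_apply] }
        have hf : ∀ a, α a * f = f * α a := fun a => LinearMap.ext fun m => (e.map_smul a m).symm
        exact LinearMap.congr_fun (hz f hf) m }
  let b := Module.finBasis K M
  obtain ⟨a, ha⟩ := jacobson_density (R := A) (M := M) z' (Finset.univ.image b)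
  exact ⟨a, b.ext fun i => (ha (b i) (Finset.mem_image_of_mem _ (Finset.mem_univ i))).symm⟩

/-- The commutant of an isotypic representation is simple. -/
theorem isSimpleRing_commutant {S ι : Type*} [AddCommGroup S] [Module K S] [Module A S]
    [IsScalarTower K A S] [IsSimpleModule A S] [Finite ι] [Nonempty ι] (α : A →ₐ[K] End K M)
    (e : M ≃ₗ[K] (ι → S)) (he : ∀ a m, e (α a m) = a • e m) (R : Subalgebra K (End K M))
    (hR : ∀ f, f ∈ R ↔ ∀ a, α a * f = f * α a) : IsSimpleRing R := by
  classical
  have := Fintype.ofFinite ι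
  have he' : ∀ a x, α a (e.symm x) = e.symm (a • x) := fun a x => by
    rw [e.eq_symm_apply, he, e.apply_symm_apply]
  have := IsSimpleModule.nontrivial A S
  -- By Schur's lemma $\operatorname{End}_A(S)$ is a division ring, and the commutant is the matrix
  -- ring over it.
  have : IsSimpleRing (Matrix ι ι (End A S)) := inferInstance
  have : IsSimpleRing (End A (ι → S)) :=
    isSimpleRing_of_surjective (endVecRingEquivMatrixEnd ι A S).symm.toRingHom
      (endVecRingEquivMatrixEnd ι A S).symm.surjective
  have hnt : Nontrivial M := e.toEquiv.nontrivial
  have : Nontrivial R := by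
    have : Nontrivial (End K M) := inferInstance
    exact ⟨⟨0, 1, fun h => zero_ne_one (congrArg Subtype.val h)⟩⟩
  let θ : End A (ι → S) →+* R :=
    { toFun := fun f => ⟨e.symm.toLinearMap ∘ₗ f.restrictScalars K ∘ₗ e.toLinearMap, by
        rw [hR]
        intro a
        refine LinearMap.ext fun m => ?_
        simp [he, he']⟩
      map_one' := Subtype.ext (LinearMap.ext fun m => by simp)
      map_zero' := Subtype.ext (LinearMap.ext fun m => by simp)
      map_add' := fun f g => Subtype.ext (LinearMap.ext fun m => by simp)
      map_mul' := fun f g => Subtype.ext (LinearMap.ext fun m => by simp) }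
  refine isSimpleRing_of_surjective θ fun r => ?_
  refine ⟨{ toFun := fun x => e (r.1 (e.symm x)), map_add' := fun x y => by simp,
            map_smul' := fun a x => ?_ }, Subtype.ext (LinearMap.ext fun m => ?_)⟩
  · have h := LinearMap.congr_fun ((hR r.1).1 r.2 a) (e.symm x)
    simp only [End.mul_apply] at h
    rw [← he', ← h, he, RingHom.id_apply]
  · change e.symm (e (r.1 (e.symm (e m)))) = r.1 m
    simp

end Commutant

/-! ### Irreducible representations of finite groups -/

section Irreducible

variable {K : Type*} [Field K] {G : Type*} [Group G] [Finite G]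
  {W : Type*} [AddCommGroup W] [Module K W]

theorem isSemisimpleRing_groupAlgebra [CharZero K] : IsSemisimpleRing K[G] := by
  have : NeZero (Nat.card G : K) := ⟨by exact_mod_cast Nat.card_pos.ne'⟩
  infer_instance

instance Representation.isScalarTower_asModule (ρ : Representation K G W) :
    IsScalarTower K K[G] ρ.asModule :=
  ⟨fun k x w => by
    apply ρ.asModuleEquiv.injective
    rw [ρ.asModuleEquiv_map_smul, map_smul, map_smul, ρ.asModuleEquiv_map_smul]
    rfl⟩

theorem Representation.IsIrreducible.finiteDimensional {ρ : Representation K G W}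
    (h : ρ.IsIrreducible) : FiniteDimensional K W :=
  have : Module.Finite K[G] ρ.asModule := inferInstance
  (Module.Finite.trans K[G] ρ.asModule : Module.Finite K ρ.asModule)

/-- Only the irreducibility of $\rho$ enters: a nonzero map out of $\rho$ is injective, one into
$\rho$ is surjective, and equal dimensions make either bijective. -/
theorem Representation.IsIrreducible.eq_zero_of_not_equiv_dual {ρ : Representation K G W}
    (h : ρ.IsIrreducible) (hd : ¬ Nonempty (ρ.Equiv ρ.dual)) :
    (∀ f : ρ.IntertwiningMap ρ.dual, f = 0) ∧ ∀ f : ρ.dual.IntertwiningMap ρ, f = 0 := by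
  have := h.finiteDimensional
  have hr : finrank K (Dual K W) = finrank K W := Subspace.dual_finrank_eq
  constructor
  · intro f
    refine (IsIrreducible.injective_or_eq_zero f).resolve_left fun hi => hd ⟨f.ofBijective ⟨hi, ?_⟩⟩
    exact (LinearMap.injective_iff_surjective_of_finrank_eq_finrank
      (f := f.toLinearMap) hr.symm).1 hi
  · intro f
    refine (IsIrreducible.surjective_or_eq_zero f).resolve_left fun hi =>
      hd ⟨(f.ofBijective ⟨?_, hi⟩).symm⟩
    exact (LinearMap.injective_iff_surjective_of_finrank_eq_finrank
      (f := f.toLinearMap) hr).2 hi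

/-- If `ρ` is not self-dual, the factor of the group algebra associated to `{ρ, ρ*}` contains a
skew-symmetric central square root of `1`. -/
theorem exists_central_skew [CharZero K] {ρ : Representation K G W} (h : ρ.IsIrreducible)
    (hd : ¬ Nonempty (ρ.Equiv ρ.dual)) : ∃ z : GroupAlgFactor ρ,
      (∀ x, z * x = x * z) ∧ z * z = 1 ∧ factorInvolution ρ z = -z := by
  have := h.finiteDimensional
  have := isSemisimpleRing_groupAlgebra (K := K) (G := G)
  obtain ⟨h1, h2⟩ := h.eq_zero_of_not_equiv_dual hd
  -- $z_0=(1,-1)$ commutes with every endomorphism of $\rho\oplus\rho^*$, since none mixes the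
  -- summands. By the double commutant theorem it is the action of some $x\in K[G]$.
  let z₀ : End K (W × Dual K W) := (LinearMap.id : W →ₗ[K] W).prodMap (-LinearMap.id)
  have hz₀ : ∀ w, z₀ w = (w.1, -w.2) := fun w => rfl
  obtain ⟨x, hx⟩ := exists_of_mem_double_commutant (ρ.prod ρ.dual).asAlgebraHom z₀ fun f hf => by
    have hfg : ∀ g, f ∘ₗ (ρ.prod ρ.dual) g = (ρ.prod ρ.dual) g ∘ₗ f := fun g => by
      have := hf (MonoidAlgebra.single g 1)
      rw [Representation.asAlgebraHom_single_one] at this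
      exact this.symm
    let F : (ρ.prod ρ.dual).IntertwiningMap (ρ.prod ρ.dual) := ⟨f, hfg⟩
    have e1 := h1 ((Representation.IntertwiningMap.snd K ρ ρ.dual).comp
      (F.comp (Representation.IntertwiningMap.inl K ρ ρ.dual)))
    have e2 := h2 ((Representation.IntertwiningMap.fst K ρ ρ.dual).comp
      (F.comp (Representation.IntertwiningMap.inr K ρ ρ.dual)))
    have e1' : ∀ w, (f (w, 0)).2 = 0 := fun w =>
      congrArg (fun φ : ρ.IntertwiningMap ρ.dual => φ w) e1
    have e2' : ∀ η, (f (0, η)).1 = 0 := fun η =>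
      congrArg (fun φ : ρ.dual.IntertwiningMap ρ => φ η) e2
    refine LinearMap.ext fun w => ?_
    have hw : w = (w.1, 0) + (0, w.2) := by simp
    have hzw : z₀ w = (w.1, 0) - (0, w.2) := by rw [hz₀]; simp
    rw [End.mul_apply, End.mul_apply, hzw, map_sub, hz₀]
    conv_lhs => rw [hw, map_add]
    refine Prod.ext ?_ ?_
    · simp [e2']
    · simp [e1']
  have hx' : ∀ w : W × Dual K W, (ρ.asAlgebraHom x w.1, ρ.dual.asAlgebraHom x w.2) =
      (w.1, -w.2) := fun w => by
    rw [← prod_asAlgebraHom, hx, hz₀]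
  have hx1 : ρ.asAlgebraHom x = 1 :=
    LinearMap.ext fun w => congrArg Prod.fst (hx' (w, 0))
  have hx2 : ρ.dual.asAlgebraHom x = -1 :=
    LinearMap.ext fun η => congrArg Prod.snd (hx' (0, η))
  have key : ∀ y, ρ.asAlgebraHom y = 0 → ρ.dual.asAlgebraHom y = 0 →
      Ideal.Quotient.mk (factorIdeal ρ) y = 0 := fun y hy hy' =>
    Ideal.Quotient.eq_zero_iff_mem.2 ((mem_factorIdeal ρ y).2 ⟨hy, hy'⟩)
  -- The involution exchanges, up to transposition, the actions on $\rho$ and $\rho^*$; hence it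
  -- turns $(1,-1)$ into $(-1,1)$.
  have hinv : ρ.asAlgebraHom (groupAlgInv K G x).unop = -1 := by
    rw [← sub_eq_zero, sub_neg_eq_add]
    apply transpose_eq_zero
    rw [map_add, ← dual_asAlgebraHom, hx2]
    refine LinearMap.ext fun η => LinearMap.ext fun w => ?_
    simp [Dual.transpose_apply]
  refine ⟨Ideal.Quotient.mk _ x, fun y => ?_, ?_, ?_⟩
  · obtain ⟨y, rfl⟩ := Ideal.Quotient.mk_surjective y
    rw [← map_mul, ← map_mul, ← sub_eq_zero, ← map_sub]
    refine key _ ?_ ?_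
    · rw [map_sub, map_mul, map_mul, hx1, one_mul, mul_one, sub_self]
    · rw [map_sub, map_mul, map_mul, hx2]
      exact LinearMap.ext fun η => by simp
  · rw [← map_mul, ← map_one (Ideal.Quotient.mk (factorIdeal ρ)), ← sub_eq_zero, ← map_sub]
    refine key _ ?_ ?_
    · rw [map_sub, map_mul, map_one, hx1, one_mul, sub_self]
    · rw [map_sub, map_mul, map_one, hx2]
      exact LinearMap.ext fun η => by simp
  · change (factorInvolutionOp ρ (Ideal.Quotient.mk (factorIdeal ρ) x)).unop = _
    rw [factorInvolutionOp_mk, ← sub_eq_zero, sub_neg_eq_add, ← map_add]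
    refine key _ ?_ ?_
    · rw [map_add, hinv, hx1, neg_add_cancel]
    · rw [map_add, dual_asAlgebraHom, groupAlgInv_groupAlgInv, hx1, hx2]
      refine LinearMap.ext fun η => LinearMap.ext fun w => ?_
      simp [Dual.transpose_apply]

end Irreducible

/-! ### The Lie algebra `𝔰(R, σ)` of an algebra with a hyperbolic pair -/

namespace AlgInvolution

variable {K R : Type*} [Field K] [Ring R] [Algebra K R] (σ : AlgInvolution K R)

/-- The element of the algebra that underlies an element of `𝔰(R, σ)`. -/
def derivedSkewCoe : σ.derivedSkew →ₗ[K] R :=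
  σ.skew.toSubmodule.subtype ∘ₗ σ.derivedSkew.toSubmodule.subtype

variable {σ}

theorem derivedSkewCoe_injective : Function.Injective σ.derivedSkewCoe := fun _ _ h =>
  Subtype.ext (Subtype.ext h)

theorem derivedSkewCoe_lie (x y : σ.derivedSkew) : σ.derivedSkewCoe ⁅x, y⁆ =
    σ.derivedSkewCoe x * σ.derivedSkewCoe y - σ.derivedSkewCoe y * σ.derivedSkewCoe x := rfl

theorem skew_derivedSkewCoe (x : σ.derivedSkew) : σ (σ.derivedSkewCoe x) = -σ.derivedSkewCoe x :=
  x.1.2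

theorem exists_derivedSkew {x y : R} (hx : σ x = -x) (hy : σ y = -y) :
    ∃ z : σ.derivedSkew, σ.derivedSkewCoe z = x * y - y * x := by
  let x' : σ.skew := ⟨x, hx⟩
  let y' : σ.skew := ⟨y, hy⟩
  have h : ⁅x', y'⁆ ∈ σ.derivedSkew := by
    rw [derivedSkew, LieAlgebra.derivedSeries_def, LieAlgebra.derivedSeriesOfIdeal_succ,
      LieAlgebra.derivedSeriesOfIdeal_zero]
    exact LieSubmodule.lie_mem_lie trivial trivial
  exact ⟨⟨_, h⟩, rfl⟩

theorem derivedSkewCoe_mem {N : Submodule K R}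
    (hN : ∀ x y, σ x = -x → σ y = -y → x * y - y * x ∈ N) (x : σ.derivedSkew) :
    σ.derivedSkewCoe x ∈ N := by
  have h : σ.derivedSkew.toSubmodule ≤ N.comap σ.skew.toSubmodule.subtype := by
    rw [derivedSkew, LieAlgebra.derivedSeries_def, LieAlgebra.derivedSeriesOfIdeal_succ,
      LieAlgebra.derivedSeriesOfIdeal_zero, LieSubmodule.lieIdeal_oper_eq_linear_span',
      Submodule.span_le]
    rintro _ ⟨y, _, z, _, rfl⟩
    exact hN _ _ y.2 z.2
  exact h x.2

end AlgInvolution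

namespace IsHyperbolicPair

open AlgInvolution

variable {K R : Type*} [Field K] [CharZero K] [Ring R] [Algebra K R] {σ : AlgInvolution K R}
  {u v : R} (p : IsHyperbolicPair σ u v)

-- The grading element `p.diag 1`, which is $uv-vu$, satisfies $[\mathrm{diag}(1),bu]=2bu$, so $bu$
-- is itself a commutator of skew elements. For $v$ the eigenvalue is $-2$.
include p in
theorem exists_derivedSkew_u {b : p.core} (hb : p.coreInvolution b = b) :
    ∃ x : σ.derivedSkew, σ.derivedSkewCoe x = b * u := by
  obtain ⟨z, hz⟩ := exists_derivedSkew (p.skew_diag 1) (p.skew_u hb)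
  refine ⟨(2 : K)⁻¹ • z, ?_⟩
  rw [map_smul, hz, lie_diag_u, AlgInvolution.apply_one, one_mul, mul_one, ← two_smul K,
    Subalgebra.coe_smul, smul_mul_assoc, inv_smul_smul₀ two_ne_zero]

include p in
theorem exists_derivedSkew_v {b : p.core} (hb : p.coreInvolution b = b) :
    ∃ x : σ.derivedSkew, σ.derivedSkewCoe x = b * v := by
  obtain ⟨z, hz⟩ := exists_derivedSkew (p.skew_diag 1) (p.skew_v hb)
  refine ⟨-(2 : K)⁻¹ • z, ?_⟩
  rw [map_smul, hz, lie_diag_v, AlgInvolution.apply_one, one_mul, mul_one, ← two_smul K,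
    ← smul_neg, Subalgebra.coe_smul, smul_mul_assoc, NegMemClass.coe_neg, neg_mul, neg_smul,
    smul_neg, smul_neg, neg_neg, inv_smul_smul₀ two_ne_zero]

variable {S : Set σ.derivedSkew}
  (hS : ∀ x, x ∈ S ↔ (∃ b, p.coreInvolution b = b ∧ σ.derivedSkewCoe x = b * u) ∨
    ∃ b, p.coreInvolution b = b ∧ σ.derivedSkewCoe x = b * v)

include hS in
theorem exists_lieSpan_u {b : p.core} (hb : p.coreInvolution b = b) :
    ∃ x ∈ LieSubalgebra.lieSpan K σ.derivedSkew S, σ.derivedSkewCoe x = b * u := by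
  obtain ⟨x, hx⟩ := p.exists_derivedSkew_u hb
  exact ⟨x, LieSubalgebra.subset_lieSpan ((hS x).2 (Or.inl ⟨b, hb, hx⟩)), hx⟩

include hS in
theorem exists_lieSpan_v {b : p.core} (hb : p.coreInvolution b = b) :
    ∃ x ∈ LieSubalgebra.lieSpan K σ.derivedSkew S, σ.derivedSkewCoe x = b * v := by
  obtain ⟨x, hx⟩ := p.exists_derivedSkew_v hb
  exact ⟨x, LieSubalgebra.subset_lieSpan ((hS x).2 (Or.inr ⟨b, hb, hx⟩)), hx⟩

include hS in
/-- `𝔰(R, σ)` is generated in degrees `± 2` if all commutators of the centralizer are combinations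
of products of symmetric elements. -/
theorem lieSpan_eq_top (hp : ∀ x y, x * y - y * x ∈ p.coreInvolution.symMul) :
    LieSubalgebra.lieSpan K σ.derivedSkew S = ⊤ := by
  rw [eq_top_iff]
  intro x _
  obtain ⟨y, hy, hxy⟩ := derivedSkewCoe_mem
    (N := (LieSubalgebra.lieSpan K σ.derivedSkew S).toSubmodule.map σ.derivedSkewCoe)
    (fun x y hx hy => p.commutator_mem_of_symMul hp _ (by
      rintro _ ⟨x, hx, rfl⟩ _ ⟨y, hy, rfl⟩
      exact ⟨⁅x, y⁆, LieSubalgebra.lie_mem _ hx hy, derivedSkewCoe_lie x y⟩)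
      (fun b hb => p.exists_lieSpan_u hS hb) (fun b hb => p.exists_lieSpan_v hS hb) hx hy) x
  rwa [← derivedSkewCoe_injective hxy]

include hS in
/-- If the symmetric elements of the centralizer form a copy of `F` in the centre, the elements of
degree `± 2` generate a copy of `sl₂(F)`. -/
theorem exists_equiv_slTwo {F : Type*} [CommRing F] [Algebra K F] (t : F →ₐ[K] R)
    (ht : Function.Injective t) (hc : ∀ z x, t z * x = x * t z)
    (hH : ∀ b : p.core, p.coreInvolution b = b ↔ ∃ z, t z = b) :
    ∃ e : LieSubalgebra.lieSpan K σ.derivedSkew S ≃ₗ⁅K⁆ slTwo K F,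
      ∀ (z : F) (x : LieSubalgebra.lieSpan K σ.derivedSkew S),
        ∃ y : LieSubalgebra.lieSpan K σ.derivedSkew S,
          σ.derivedSkewCoe y = t z * σ.derivedSkewCoe x ∧
            ∀ i j, (e y).1 i j = z * (e x).1 i j := by
  let t' : F →ₐ[K] p.core := t.codRestrict p.core fun z =>
    p.mem_core.2 ⟨(hc z u).symm, (hc z v).symm⟩
  have ht' : Function.Injective t' := fun x y h => ht (congrArg Subtype.val h)
  have hsym : ∀ z, p.coreInvolution (t' z) = t' z := fun z => (hH _).2 ⟨z, rfl⟩
  -- The copy of $M_2(F)$ inside $R\cong M_2(C)$; the generated Lie algebra is the image of its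
  -- trace-zero part.
  let Φ : Matrix (Fin 2) (Fin 2) F →ₐ[K] R := p.matrixHom.comp t'.mapMatrix
  have hΦ : Function.Injective Φ :=
    p.matrixEquiv.injective.comp (Matrix.map_injective ht')
  have hΦ' : ∀ M, Φ M = t' (M 0 0) * (u * v) + t' (M 0 1) * u + t' (M 1 0) * v +
    t' (M 1 1) * (v * u) := fun M => rfl
  have htr : ∀ M : Matrix (Fin 2) (Fin 2) F, M ∈ slTwo K F ↔ M 1 1 = -M 0 0 := fun M => by
    have h1 : M ∈ slTwo K F ↔ Matrix.trace M = 0 := Iff.rfl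
    rw [h1, Matrix.trace_fin_two, add_comm, add_eq_zero_iff_eq_neg]
  have h1 : ∀ M : slTwo K F, ∃ x : LieSubalgebra.lieSpan K σ.derivedSkew S,
      σ.derivedSkewCoe x = Φ M.1 := by
    rintro ⟨M, hM⟩
    rw [htr] at hM
    obtain ⟨x, hx, hx'⟩ := p.exists_lieSpan_u hS (hsym (M 0 1))
    obtain ⟨y, hy, hy'⟩ := p.exists_lieSpan_v hS (hsym (M 1 0))
    -- The diagonal part of $M$ is the bracket $[M_{00}u,v]$.
    obtain ⟨a, ha, ha'⟩ := p.exists_lieSpan_u hS (hsym (M 0 0))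
    obtain ⟨b, hb, hb'⟩ := p.exists_lieSpan_v hS (hsym 1)
    refine ⟨⟨⁅a, b⁆ + x + y, add_mem (add_mem (LieSubalgebra.lie_mem _ ha hb) hx) hy⟩, ?_⟩
    change σ.derivedSkewCoe (⁅a, b⁆ + x + y) = Φ M
    rw [map_add, map_add, derivedSkewCoe_lie, ha', hb', p.lie_u_v (hsym _) (hsym _), hx', hy', hΦ',
      map_one, mul_one, diag, hsym, hM, map_neg, NegMemClass.coe_neg, neg_mul]
    abel
  have h2 : ∀ x : LieSubalgebra.lieSpan K σ.derivedSkew S, ∃ M : slTwo K F,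
      Φ M.1 = σ.derivedSkewCoe x := by
    rintro ⟨x, hx⟩
    let N : LieSubalgebra K σ.derivedSkew :=
      { carrier := {x | ∃ M : slTwo K F, Φ M.1 = σ.derivedSkewCoe x}
        add_mem' := by
          rintro x y ⟨M, hM⟩ ⟨M', hM'⟩
          refine ⟨M + M', ?_⟩
          rw [map_add, ← hM, ← hM', ← map_add]
          rfl
        zero_mem' := ⟨0, by rw [map_zero]; exact map_zero Φ⟩
        smul_mem' := by
          rintro c x ⟨M, hM⟩
          refine ⟨c • M, ?_⟩
          rw [map_smul, ← hM, ← map_smul]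
          rfl
        lie_mem' := by
          rintro x y ⟨M, hM⟩ ⟨M', hM'⟩
          refine ⟨⁅M, M'⁆, ?_⟩
          rw [derivedSkewCoe_lie, ← hM, ← hM', ← map_mul, ← map_mul, ← map_sub]
          rfl }
    have hN : LieSubalgebra.lieSpan K σ.derivedSkew S ≤ N := by
      rw [LieSubalgebra.lieSpan_le]
      intro x hx
      rcases (hS x).1 hx with ⟨b, hb, hx⟩ | ⟨b, hb, hx⟩
      · obtain ⟨z, hz⟩ := (hH b).1 hb
        refine ⟨⟨!![0, z; 0, 0], (htr _).2 (by simp)⟩, ?_⟩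
        rw [hΦ', hx, ← hz]
        simp [t']
      · obtain ⟨z, hz⟩ := (hH b).1 hb
        refine ⟨⟨!![0, 0; z, 0], (htr _).2 (by simp)⟩, ?_⟩
        rw [hΦ', hx, ← hz]
        simp [t']
    exact hN hx
  choose f hf using h1
  choose m hm using h2
  have hinj : ∀ M M' : slTwo K F, Φ M.1 = Φ M'.1 → M = M' := fun M M' h => Subtype.ext (hΦ h)
  let e : LieSubalgebra.lieSpan K σ.derivedSkew S ≃ₗ⁅K⁆ slTwo K F :=
    { toFun := m
      map_add' := fun x y => hinj _ _ (by
        rw [hm]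
        change σ.derivedSkewCoe (x.1 + y.1) = Φ ((m x).1 + (m y).1)
        rw [map_add, map_add, hm, hm])
      map_smul' := fun c x => hinj _ _ (by
        rw [hm]
        change σ.derivedSkewCoe (c • x.1) = Φ (c • (m x).1)
        rw [map_smul, map_smul, hm])
      map_lie' := fun {x y} => hinj _ _ (by
        rw [hm]
        change σ.derivedSkewCoe ⁅x.1, y.1⁆ = Φ ((m x).1 * (m y).1 - (m y).1 * (m x).1)
        rw [derivedSkewCoe_lie, map_sub, map_mul, map_mul, hm, hm])
      invFun := f
      left_inv := fun x => Subtype.ext (derivedSkewCoe_injective (by rw [hf, hm]))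
      right_inv := fun M => hinj _ _ (by rw [hm, hf]) }
  refine ⟨e, fun z x => ?_⟩
  have hz : z • (m x).1 ∈ slTwo K F := by
    have := (htr _).1 (m x).2
    rw [htr, Matrix.smul_apply, Matrix.smul_apply, this, smul_neg]
  refine ⟨f ⟨_, hz⟩, ?_, fun i j => ?_⟩
  · rw [hf, ← hm, hΦ', hΦ']
    simp only [Matrix.smul_apply, smul_eq_mul, map_mul, Subalgebra.coe_mul, mul_add, mul_assoc]
    rfl
  · have : m (f ⟨_, hz⟩) = ⟨_, hz⟩ := hinj _ _ (by rw [hm, hf])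
    change (m (f ⟨_, hz⟩)).1 i j = _
    rw [this]
    rfl

end IsHyperbolicPair

/-! ### The exceptional case -/

namespace IsHyperbolicPair

variable {K R : Type*} [Field K] [CharZero K] [Ring R] [Algebra K R] [FiniteDimensional K R]
  {σ : AlgInvolution K R} {u v : R} (p : IsHyperbolicPair σ u v)

include p in
/-- An algebra with an involution of the first kind and a hyperbolic pair, over its centre. -/
theorem exists_over_center [IsSimpleRing R] (hσ : σ.IsFirstKind) {F : Type*} [Field F]
    [Algebra F R] (hF : ∀ z : R, z ∈ Subring.center R ↔ z ∈ (algebraMap F R).range) :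
    CharZero F ∧ FiniteDimensional F R ∧ Algebra.IsCentral F R ∧
      ∃ σ' : AlgInvolution F R, (∀ x, σ' x = σ x) ∧ IsHyperbolicPair σ' u v := by
  have : CharZero R := charZero_of_injective_algebraMap (algebraMap K R).injective
  -- $F$ carries no $K$-algebra structure here, but the scalars of $K$ act on $R$ through the image
  -- of $F$.
  have hK : ∀ k : K, ∃ z : F, algebraMap F R z = algebraMap K R k := fun k =>
    (hF _).1 (Subring.mem_center_iff.2 fun x => (Algebra.commutes k x).symm)
  refine ⟨?_, ?_, ⟨?_⟩, ?_⟩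
  · refine ⟨fun m n h => ?_⟩
    have := congrArg (algebraMap F R) h
    rw [map_natCast, map_natCast] at this
    exact Nat.cast_injective this
  · let b := Module.finBasis K R
    refine Module.Finite.of_fg_top ⟨Finset.univ.map ⟨b, b.injective⟩, ?_⟩
    rw [eq_top_iff]
    intro x _
    rw [← b.sum_repr x]
    refine Submodule.sum_mem _ fun i _ => ?_
    obtain ⟨z, hz⟩ := hK (b.repr x i)
    rw [Algebra.smul_def, ← hz, ← Algebra.smul_def]
    exact Submodule.smul_mem _ _ (Submodule.subset_span (by simp))
  · intro z hz
    obtain ⟨c, hc⟩ := (hF z).1 (Subring.mem_center_iff.2 (Subalgebra.mem_center_iff.1 hz))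
    exact Algebra.mem_bot.2 ⟨c, hc⟩
  · exact ⟨{ toFun := σ
             map_add' := map_add σ.toLinearMap
             -- Being of the first kind is exactly what makes $\sigma$ linear over the centre.
             map_smul' := fun z x => by
              have hz : algebraMap F R z ∈ Subring.center R := (hF _).2 ⟨z, rfl⟩
              rw [Algebra.smul_def, σ.map_mul_rev, hσ _ hz, RingHom.id_apply, Algebra.smul_def,
                Algebra.commutes]
             map_mul_rev' := σ.map_mul_rev
             involutive' := σ.apply_apply }, fun x => rfl,
      ⟨p.mul_self_left, p.mul_self_right, p.add_eq_one, p.skew_left, p.skew_right⟩⟩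

/-- If the centralizer is not commutative and its symmetric elements are the central ones, the
involution is orthogonal and the algebra has degree `4`. -/
theorem isOrthogonal_of_sym_eq_center [IsSimpleRing R]
    (hsym : ∀ b, p.coreInvolution b = b ↔ b ∈ Subring.center p.core)
    (hcomm : ∃ x y : p.core, x * y ≠ y * x) : σ.IsOrthogonal ∧ algDegree R = 4 := by
  have hfirst : σ.IsFirstKind := fun z hz => by
    have h : (⟨z, p.mem_core_of_mem_center hz⟩ : p.core) ∈ Subring.center p.core :=
      Subring.mem_center_iff.2 fun x => Subtype.ext (Subring.mem_center_iff.1 hz x)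
    exact congrArg Subtype.val ((hsym _).2 h)
  let : Field (Subring.center R) := (IsSimpleRing.isField_center R).toField
  obtain ⟨h1, h2, h3, σ', hσ', p'⟩ := p.exists_over_center (F := Subring.center R) hfirst
    fun z => ⟨fun hz => ⟨⟨z, hz⟩, rfl⟩, fun ⟨w, hw⟩ => hw ▸ w.2⟩
  have hmem : ∀ x, x ∈ p'.core ↔ x ∈ p.core := fun x => by rw [p'.mem_core, p.mem_core]
  -- Symmetric elements of the centralizer are central in it, hence central in $R$: they form the
  -- line $Z(R)\cdot1$.
  have hone : finrank (Subring.center R)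
      (LinearMap.eqLocus p'.coreInvolution.toLinearMap LinearMap.id) = 1 := by
    refine finrank_eq_one (⟨1, p'.coreInvolution.apply_one⟩ :
      LinearMap.eqLocus p'.coreInvolution.toLinearMap LinearMap.id)
      (fun h => one_ne_zero (α := R) (congrArg (fun x => x.1.1) h)) fun w => ?_
    have hw : σ' (w : p'.core) = (w : p'.core) := congrArg Subtype.val w.2
    rw [hσ'] at hw
    have hw' := (hsym ⟨_, (hmem _).1 w.1.2⟩).1 (Subtype.ext hw)
    refine ⟨⟨_, p.mem_center_of_mem_center_core hw'⟩, Subtype.ext (Subtype.ext ?_)⟩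
    exact mul_one _
  have hN : finrank (Subring.center R) p'.core ≠ 1 := fun h => by
    obtain ⟨x, y, hxy⟩ := hcomm
    have h' := (finrank_eq_one_iff_of_nonzero' (1 : p'.core) one_ne_zero).1 h
    obtain ⟨c, hc⟩ := h' ⟨x, (hmem _).2 x.2⟩
    have hc' : (c : R) = x := by
      rw [← mul_one (c : R)]
      exact congrArg Subtype.val hc
    refine hxy (Subtype.ext ?_)
    change (x : R) * y = y * x
    rw [← hc']
    exact (Subring.mem_center_iff.1 c.2 y).symm
  obtain ⟨φ, g, hg, hs, hφ⟩ := p'.orthogonal_of_finrank_sym_eq_one hone hN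
    (AlgebraicClosure (Subring.center R))
  refine ⟨⟨inferInstance, hfirst, AlgebraicClosure (Subring.center R), inferInstance,
    inferInstance, 4, φ, g, hg, hs, fun x => ?_⟩, ?_⟩
  · rw [← hφ, hσ']
  · have := finrank_eq_mul_self φ
    rw [algDegree, this]
    exact Nat.sqrt_eq 4

/-- If the involution is orthogonal and the algebra has degree `4`, the symmetric elements of the
centralizer are central. -/
theorem mem_center_of_isOrthogonal (h : σ.IsOrthogonal) (hdeg : algDegree R = 4) {b : p.core}
    (hb : p.coreInvolution b = b) : (b : R) ∈ Subring.center R := by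
  obtain ⟨hsimple, hfirst, L, _, _, d, φ, g, hg, hs, hφ⟩ := h
  let : Field (Subring.center R) := (IsSimpleRing.isField_center R).toField
  obtain ⟨h1, h2, h3, σ', hσ', p'⟩ := p.exists_over_center (F := Subring.center R) hfirst
    fun z => ⟨fun hz => ⟨⟨z, hz⟩, rfl⟩, fun ⟨w, hw⟩ => hw ▸ w.2⟩
  have hmem : ∀ x, x ∈ p'.core ↔ x ∈ p.core := fun x => by rw [p'.mem_core, p.mem_core]
  -- The matrix size over the given splitting field is determined by the dimension $d^2$ over the
  -- centre.
  have hd : d = 4 := by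
    have := finrank_eq_mul_self φ
    rw [algDegree, this, Nat.sqrt_eq] at hdeg
    exact hdeg
  subst hd
  have hone := p'.finrank_sym_eq_one φ g hg hs fun x => by rw [hσ', hφ]
  have h' := (finrank_eq_one_iff_of_nonzero' (⟨1, p'.coreInvolution.apply_one⟩ :
      LinearMap.eqLocus p'.coreInvolution.toLinearMap LinearMap.id)
      (fun h => one_ne_zero (α := R) (congrArg (fun x => x.1.1) h))).1 hone
  obtain ⟨c, hc⟩ := h' ⟨⟨b, (hmem _).2 b.2⟩, Subtype.ext ((hσ' _).trans (congrArg Subtype.val hb))⟩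
  have hc' : (c : R) = b := by
    rw [← mul_one (c : R)]
    exact congrArg (fun x => x.1.1) hc
  rw [← hc']
  exact c.2

end IsHyperbolicPair

/-! ### The algebra `Ã` -/

section Degree

variable {K V : Type*} [Field K] [AddCommGroup V] [Module K V]

theorem tildeGrading_one : tildeGrading K V 1 = LinearMap.range (LinearMap.inl K V (Dual K V)) :=
  if_pos rfl

theorem tildeGrading_neg_one :
    tildeGrading K V (-1) = LinearMap.range (LinearMap.inr K V (Dual K V)) :=
  (if_neg (by decide)).trans (if_pos rfl)

theorem tildeGrading_eq_bot {i : ℤ} (h1 : i ≠ 1) (h2 : i ≠ -1) : tildeGrading K V i = ⊥ :=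
  (if_neg h1).trans (if_neg h2)

variable (K V) in
/-- The inclusion of `V` into `Ṽ`. -/
def tildeInl : V →ₗ[K] Tilde K V := LinearMap.inl K V (Dual K V)

variable (K V) in
/-- The inclusion of `V*` into `Ṽ`. -/
def tildeInr : Dual K V →ₗ[K] Tilde K V := LinearMap.inr K V (Dual K V)

variable (K V) in
/-- The projection of `Ṽ` onto `V`. -/
def tildeFst : Tilde K V →ₗ[K] V := LinearMap.fst K V (Dual K V)

variable (K V) in
/-- The projection of `Ṽ` onto `V*`. -/
def tildeSnd : Tilde K V →ₗ[K] Dual K V := LinearMap.snd K V (Dual K V)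

@[simp] theorem tildeFst_inl (v : V) : tildeFst K V (tildeInl K V v) = v := rfl

@[simp] theorem tildeSnd_inl (v : V) : tildeSnd K V (tildeInl K V v) = 0 := rfl

@[simp] theorem tildeFst_inr (η : Dual K V) : tildeFst K V (tildeInr K V η) = 0 := rfl

@[simp] theorem tildeSnd_inr (η : Dual K V) : tildeSnd K V (tildeInr K V η) = η := rfl

theorem tilde_ext {x y : Tilde K V} (h1 : tildeFst K V x = tildeFst K V y)
    (h2 : tildeSnd K V x = tildeSnd K V y) : x = y := Prod.ext h1 h2

theorem tildeInl_add_tildeInr (x : Tilde K V) :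
    tildeInl K V (tildeFst K V x) + tildeInr K V (tildeSnd K V x) = x :=
  tilde_ext (by simp) (by simp)

theorem tildeForm_eq (x y : Tilde K V) : tildeForm K V x y =
    tildeSnd K V x (tildeFst K V y) + tildeSnd K V y (tildeFst K V x) := rfl

theorem endHasDegree_two_iff (f : End K (Tilde K V)) : EndHasDegree 2 f ↔
    (∀ v : V, f (tildeInl K V v) = 0) ∧ ∀ η, tildeSnd K V (f (tildeInr K V η)) = 0 := by
  constructor
  · intro h
    refine ⟨fun v => ?_, fun η => ?_⟩
    · have := h 1 (tildeInl K V v) (by rw [tildeGrading_one]; exact ⟨v, rfl⟩)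
      rw [tildeGrading_eq_bot (by decide) (by decide)] at this
      exact this
    · have := h (-1) (tildeInr K V η) (by rw [tildeGrading_neg_one]; exact ⟨η, rfl⟩)
      rw [show (-1 + 2 : ℤ) = 1 by norm_num, tildeGrading_one] at this
      obtain ⟨v, hv⟩ := this
      rw [← hv]
      rfl
  · rintro ⟨h1, h2⟩ i x hx
    by_cases hi : i = 1
    · subst hi
      rw [tildeGrading_one] at hx
      obtain ⟨v, rfl⟩ := hx
      have : f (LinearMap.inl K V (Dual K V) v) = 0 := h1 v
      rw [this]
      exact zero_mem _
    by_cases hi' : i = -1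
    · subst hi'
      rw [tildeGrading_neg_one] at hx
      obtain ⟨η, rfl⟩ := hx
      rw [show (-1 + 2 : ℤ) = 1 by norm_num, tildeGrading_one]
      exact ⟨tildeFst K V (f (tildeInr K V η)), Prod.ext rfl (h2 η).symm⟩
    rw [tildeGrading_eq_bot hi hi', Submodule.mem_bot] at hx
    rw [hx, map_zero]
    exact zero_mem _

theorem endHasDegree_neg_two_iff (f : End K (Tilde K V)) : EndHasDegree (-2) f ↔
    (∀ v : V, tildeFst K V (f (tildeInl K V v)) = 0) ∧ ∀ η, f (tildeInr K V η) = 0 := by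
  constructor
  · intro h
    refine ⟨fun v => ?_, fun η => ?_⟩
    · have := h 1 (tildeInl K V v) (by rw [tildeGrading_one]; exact ⟨v, rfl⟩)
      rw [show (1 + -2 : ℤ) = -1 by norm_num, tildeGrading_neg_one] at this
      obtain ⟨v, hv⟩ := this
      rw [← hv]
      rfl
    · have := h (-1) (tildeInr K V η) (by rw [tildeGrading_neg_one]; exact ⟨η, rfl⟩)
      rw [tildeGrading_eq_bot (by decide) (by decide)] at this
      exact this
  · rintro ⟨h1, h2⟩ i x hx
    by_cases hi : i = 1
    · subst hi
      rw [tildeGrading_one] at hx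
      obtain ⟨v, rfl⟩ := hx
      rw [show (1 + -2 : ℤ) = -1 by norm_num, tildeGrading_neg_one]
      exact ⟨tildeSnd K V (f (tildeInl K V v)), Prod.ext (h1 v).symm rfl⟩
    by_cases hi' : i = -1
    · subst hi'
      rw [tildeGrading_neg_one] at hx
      obtain ⟨η, rfl⟩ := hx
      have : f (LinearMap.inr K V (Dual K V) η) = 0 := h2 η
      rw [this]
      exact zero_mem _
    rw [tildeGrading_eq_bot hi hi', Submodule.mem_bot] at hx
    rw [hx, map_zero]
    exact zero_mem _

end Degree

/-! ### Degrees $\pm2$ as matrix corners. -/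

namespace IsHyperbolicPair

variable {K R : Type*} [Field K] [Ring R] [Algebra K R] {σ : AlgInvolution K R}
  {u v : R} (p : IsHyperbolicPair σ u v)

/-- Among the components of $\mathrm{diag}(a)+bu+cv$, the corner $uv\,(\cdot)\,vu$ keeps only $bu$.
-/
theorem upper_iff {x : R} (hx : σ x = -x) : u * v * x * (v * u) = x ↔
    ∃ b, p.coreInvolution b = b ∧ x = b * u := by
  constructor
  · intro h
    obtain ⟨a, b, c, hb, hc, rfl⟩ := p.exists_of_skew hx
    refine ⟨b, hb, ?_⟩
    rw [← h]
    simp only [diag, mul_add, add_mul, mul_sub, sub_mul, mul_assoc, p.mul_self_left,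
      p.mul_self_right, p.uvu, p.vuv, p.uuX, p.vvX, p.uvuX, p.vuvX, p.u_comm, p.v_comm, p.u_commX,
      p.v_commX, mul_zero, zero_mul, add_zero, zero_add,
      sub_zero]
  · rintro ⟨b, hb, rfl⟩
    simp only [mul_assoc, p.mul_self_left, p.mul_self_right, p.uvu, p.vuv, p.uuX, p.vvX, p.uvuX,
      p.vuvX, p.u_comm, p.v_comm, p.u_commX, p.v_commX]

theorem lower_iff {x : R} (hx : σ x = -x) : v * u * x * (u * v) = x ↔
    ∃ b, p.coreInvolution b = b ∧ x = b * v := by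
  constructor
  · intro h
    obtain ⟨a, b, c, hb, hc, rfl⟩ := p.exists_of_skew hx
    refine ⟨c, hc, ?_⟩
    rw [← h]
    simp only [diag, mul_add, add_mul, mul_sub, sub_mul, mul_assoc, p.mul_self_left,
      p.mul_self_right, p.uvu, p.vuv, p.uuX, p.vvX, p.uvuX, p.vuvX, p.u_comm, p.v_comm, p.u_commX,
      p.v_commX, mul_zero, zero_mul, add_zero, zero_add,
      sub_zero]
  · rintro ⟨b, hb, rfl⟩
    simp only [mul_assoc, p.mul_self_left, p.mul_self_right, p.uvu, p.vuv, p.uuX, p.vvX, p.uvuX,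
      p.vuvX, p.u_comm, p.v_comm, p.u_commX, p.v_commX]

end IsHyperbolicPair

/-! ### The hyperbolic pair given by the symplectic form. -/

namespace IsotypicSetup

variable {K : Type*} [Field K] {G : Type*} [Group G]
  {V : Type*} [AddCommGroup V] [Module K V]
  {W : Type*} [AddCommGroup W] [Module K W]
  {π : Representation K G V} {ρ : Representation K G W} (h : IsotypicSetup π ρ)

theorem tildeFst_tildeAction (x : K[G]) (w : Tilde K V) :
    tildeFst K V (tildeAction (factorInvolution ρ) h.action
      (Ideal.Quotient.mk (factorIdeal ρ) x) w) = π.asAlgebraHom x (tildeFst K V w) := rfl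

theorem tildeSnd_tildeAction (x : K[G]) (w : Tilde K V) :
    tildeSnd K V (tildeAction (factorInvolution ρ) h.action
      (Ideal.Quotient.mk (factorIdeal ρ) x) w) = π.dual.asAlgebraHom x (tildeSnd K V w) := by
  rw [dual_asAlgebraHom]
  rfl

theorem mem_tildeA {f : End K (Tilde K V)} : f ∈ h.tildeA ↔ ∀ x : K[G],
    tildeAction (factorInvolution ρ) h.action (Ideal.Quotient.mk (factorIdeal ρ) x) * f =
      f * tildeAction (factorInvolution ρ) h.action (Ideal.Quotient.mk (factorIdeal ρ) x) := by
  rw [tildeA, endTilde, Subalgebra.mem_centralizer_iff]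
  constructor
  · intro hf x
    exact hf _ ⟨_, rfl⟩
  · rintro hf _ ⟨a, rfl⟩
    obtain ⟨x, rfl⟩ := Ideal.Quotient.mk_surjective a
    exact hf x

variable [FiniteDimensional K V]

include h in
/-- The symplectic isomorphism `V* ≃ V` is equivariant for the group algebra. -/
theorem exists_symplectic : ∃ J : Dual K V ≃ₗ[K] V, (∀ η θ : Dual K V, η (J θ) = -θ (J η)) ∧
    ∀ (x : K[G]) η, π.asAlgebraHom x (J η) = J (π.dual.asAlgebraHom x η) := by
  obtain ⟨n, a, h1, h2⟩ := h.lefschetz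
  obtain ⟨J, hJ, hJ'⟩ := h1.exists_symplectic h2.mem
  refine ⟨J, hJ, fun x η => ?_⟩
  let e : π.dual.Equiv π := Representation.Equiv.mk J fun g =>
    LinearMap.ext fun η => (hJ' g η).symm
  exact (equiv_asAlgebraHom e x η).symm

/-- $u$ is $J$ on $V^*$ and $v$ is $J^{-1}$ on $V$. Equivariance of $J$ puts them in the commutant,
alternation makes them skew, and $uv$, $vu$ are the projections onto $V$ and $V^*$. -/
theorem exists_hyperbolicPair : ∃ u v : h.tildeA, IsHyperbolicPair h.tildeSigma u v ∧
    (∀ x : h.tildeA, EndHasDegree 2 x.1 ↔ u * v * x * (v * u) = x) ∧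
    ∀ x : h.tildeA, EndHasDegree (-2) x.1 ↔ v * u * x * (u * v) = x := by
  obtain ⟨J, hJ, hJ'⟩ := h.exists_symplectic
  let u₀ : End K (Tilde K V) := tildeInl K V ∘ₗ J.toLinearMap ∘ₗ tildeSnd K V
  let v₀ : End K (Tilde K V) := tildeInr K V ∘ₗ J.symm.toLinearMap ∘ₗ tildeFst K V
  have hu₀ : ∀ w, u₀ w = tildeInl K V (J (tildeSnd K V w)) := fun w => rfl
  have hv₀ : ∀ w, v₀ w = tildeInr K V (J.symm (tildeFst K V w)) := fun w => rfl
  have hJ'' : ∀ (x : K[G]) v, π.dual.asAlgebraHom x (J.symm v) = J.symm (π.asAlgebraHom x v) :=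
    fun x v => by rw [J.eq_symm_apply, ← hJ', J.apply_symm_apply]
  let u : h.tildeA := ⟨u₀, h.mem_tildeA.2 fun x => LinearMap.ext fun w => by
    rw [End.mul_apply, End.mul_apply, hu₀, hu₀]
    refine tilde_ext ?_ ?_
    · rw [tildeFst_tildeAction, tildeFst_inl, tildeFst_inl, tildeSnd_tildeAction, hJ']
    · rw [tildeSnd_tildeAction, tildeSnd_inl, tildeSnd_inl, map_zero]⟩
  let v : h.tildeA := ⟨v₀, h.mem_tildeA.2 fun x => LinearMap.ext fun w => by
    rw [End.mul_apply, End.mul_apply, hv₀, hv₀]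
    refine tilde_ext ?_ ?_
    · rw [tildeFst_tildeAction, tildeFst_inr, tildeFst_inr, map_zero]
    · rw [tildeSnd_tildeAction, tildeSnd_inr, tildeSnd_inr, tildeFst_tildeAction, hJ'']⟩
  have huv : ∀ w, (u * v).1 w = tildeInl K V (tildeFst K V w) := fun w => by
    change u₀ (v₀ w) = _
    rw [hu₀, hv₀, tildeSnd_inr, J.apply_symm_apply]
  have hvu : ∀ w, (v * u).1 w = tildeInr K V (tildeSnd K V w) := fun w => by
    change v₀ (u₀ w) = _
    rw [hu₀, hv₀, tildeFst_inl, J.symm_apply_apply]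
  have hskew : ∀ x : h.tildeA, (∀ w w', tildeForm K V (x.1 w) w' = -tildeForm K V w (x.1 w')) →
      h.tildeSigma x = -x := fun x hx => by
    refine Subtype.ext ?_
    change tildeAdjoint x.1 = -x.1
    refine (eq_tildeAdjoint _ _ fun w w' => ?_).symm
    rw [LinearMap.neg_apply, map_neg, LinearMap.neg_apply, hx, neg_neg]
  refine ⟨u, v, ⟨?_, ?_, ?_, ?_, ?_⟩, fun x => ?_, fun x => ?_⟩
  · refine Subtype.ext (LinearMap.ext fun w => ?_)
    change u₀ (u₀ w) = 0
    rw [hu₀, hu₀, tildeSnd_inl, map_zero, map_zero]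
  · refine Subtype.ext (LinearMap.ext fun w => ?_)
    change v₀ (v₀ w) = 0
    rw [hv₀, hv₀, tildeFst_inr, map_zero, map_zero]
  · refine Subtype.ext (LinearMap.ext fun w => ?_)
    change (u * v).1 w + (v * u).1 w = w
    rw [huv, hvu, tildeInl_add_tildeInr]
  · refine hskew u fun w w' => ?_
    change tildeForm K V (u₀ w) w' = -tildeForm K V w (u₀ w')
    rw [hu₀, hu₀, tildeForm_eq, tildeForm_eq, tildeFst_inl, tildeSnd_inl, tildeFst_inl,
      tildeSnd_inl, hJ, LinearMap.zero_apply, LinearMap.zero_apply, zero_add, add_zero]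
  · refine hskew v fun w w' => ?_
    change tildeForm K V (v₀ w) w' = -tildeForm K V w (v₀ w')
    have := hJ (J.symm (tildeFst K V w)) (J.symm (tildeFst K V w'))
    rw [J.apply_symm_apply, J.apply_symm_apply] at this
    rw [hv₀, hv₀, tildeForm_eq, tildeForm_eq, tildeFst_inr, tildeSnd_inr, tildeFst_inr,
      tildeSnd_inr, map_zero, map_zero, zero_add, add_zero, this]
  · rw [endHasDegree_two_iff]
    constructor
    · rintro ⟨h1, h2⟩
      refine Subtype.ext (LinearMap.ext fun w => ?_)
      change (u * v).1 (x.1 ((v * u).1 w)) = x.1 w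
      rw [hvu, huv]
      conv_rhs => rw [← tildeInl_add_tildeInr w, map_add, h1, zero_add]
      exact tilde_ext (tildeFst_inl _) ((tildeSnd_inl _).trans (h2 _).symm)
    · intro hx
      have hx' : ∀ w, x.1 w = (u * v).1 (x.1 ((v * u).1 w)) := fun w =>
        congrArg (fun y : h.tildeA => y.1 w) hx.symm
      refine ⟨fun v => ?_, fun η => ?_⟩
      · rw [hx', hvu, tildeSnd_inl, map_zero, map_zero, map_zero]
      · rw [hx', huv, tildeSnd_inl]
  · rw [endHasDegree_neg_two_iff]
    constructor
    · rintro ⟨h1, h2⟩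
      refine Subtype.ext (LinearMap.ext fun w => ?_)
      change (v * u).1 (x.1 ((u * v).1 w)) = x.1 w
      rw [hvu, huv]
      conv_rhs => rw [← tildeInl_add_tildeInr w, map_add, h2, add_zero]
      exact tilde_ext ((tildeFst_inr _).trans (h1 _).symm) (tildeSnd_inr _)
    · intro hx
      have hx' : ∀ w, x.1 w = (v * u).1 (x.1 ((u * v).1 w)) := fun w =>
        congrArg (fun y : h.tildeA => y.1 w) hx.symm
      refine ⟨fun v => ?_, fun η => ?_⟩
      · rw [hx', hvu, tildeFst_inr]
      · rw [hx', huv, tildeFst_inr, map_zero, map_zero, map_zero]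

end IsotypicSetup

/-! ### Simplicity and centre of the commutant in the self-dual case. -/

namespace IsotypicSetup

variable {K : Type*} [Field K] {G : Type*} [Group G]
  {V : Type*} [AddCommGroup V] [Module K V]
  {W : Type*} [AddCommGroup W] [Module K W]
  {π : Representation K G V} {ρ : Representation K G W} (h : IsotypicSetup π ρ)

/-- The action of `K[G]` on `Ṽ`. -/
noncomputable def groupAction : K[G] →ₐ[K] End K (Tilde K V) :=
  (tildeAction (factorInvolution ρ) h.action).comp (Ideal.Quotient.mkₐ K (factorIdeal ρ))

theorem mem_tildeA_iff_groupAction {f : End K (Tilde K V)} :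
    f ∈ h.tildeA ↔ ∀ x, h.groupAction x * f = f * h.groupAction x := h.mem_tildeA

theorem tildeAction_mem {z : GroupAlgFactor ρ} (hz : ∀ x, z * x = x * z) :
    tildeAction (factorInvolution ρ) h.action z ∈ h.tildeA := by
  rw [tildeA, endTilde, Subalgebra.mem_centralizer_iff]
  rintro _ ⟨a, rfl⟩
  rw [← map_mul, ← map_mul, hz]

theorem tildeAction_comm (z : GroupAlgFactor ρ) (x : h.tildeA) :
    tildeAction (factorInvolution ρ) h.action z * x.1 =
      x.1 * tildeAction (factorInvolution ρ) h.action z :=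
  Subalgebra.mem_centralizer_iff K |>.1 x.2 _ ⟨z, rfl⟩

/-- The action on `Ṽ` of the centre of the factor of the group algebra, by elements of `Ã`. -/
noncomputable def centerAction : Subalgebra.center K (GroupAlgFactor ρ) →ₐ[K] h.tildeA :=
  ((tildeAction (factorInvolution ρ) h.action).comp
    (Subalgebra.center K (GroupAlgFactor ρ)).val).codRestrict h.tildeA fun z =>
      h.tildeAction_mem fun x => (Subalgebra.mem_center_iff.1 z.2 x).symm

theorem centerAction_comm (z : Subalgebra.center K (GroupAlgFactor ρ)) (x : h.tildeA) :
    h.centerAction z * x = x * h.centerAction z := Subtype.ext (h.tildeAction_comm z x)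

variable [FiniteDimensional K V]

/-- If `ρ` is self-dual, `Ṽ` is a power of `ρ`. -/
theorem exists_equiv_of_selfDual {n : ℕ} (e : π.Equiv (repPow ρ n)) :
    ∃ e' : Tilde K V ≃ₗ[K] (Fin n ⊕ Fin n → W), ∀ x w i,
      e' (h.groupAction x w) i = ρ.asAlgebraHom x (e' w i) := by
  obtain ⟨J, -, hJ⟩ := h.exists_symplectic
  let d : Tilde K V ≃ₗ[K] V × Dual K V := LinearEquiv.refl K (V × Dual K V)
  let f : Dual K V ≃ₗ[K] (Fin n → W) := J.trans e.toLinearEquiv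
  refine ⟨d.trans ((e.toLinearEquiv.prodCongr f).trans
    (LinearEquiv.sumArrowLequivProdArrow (Fin n) (Fin n) K W).symm), fun x w i => ?_⟩
  cases i with
  | inl i =>
    change e (π.asAlgebraHom x (tildeFst K V w)) i = ρ.asAlgebraHom x (e (tildeFst K V w) i)
    rw [equiv_asAlgebraHom, repPow_asAlgebraHom]
  | inr i =>
    change e (J (tildeSnd K V (h.groupAction x w))) i =
      ρ.asAlgebraHom x (e (J (tildeSnd K V w)) i)
    rw [groupAction, AlgHom.comp_apply, Ideal.Quotient.mkₐ_eq_mk, tildeSnd_tildeAction, ← hJ,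
      equiv_asAlgebraHom, repPow_asAlgebraHom]

/-- $\widetilde V\cong V\oplus V\cong\rho^{2n}$ is isotypic. -/
theorem isSimpleRing_tildeA [Finite G] {n : ℕ} (hn : n ≠ 0) (e : π.Equiv (repPow ρ n)) :
    IsSimpleRing h.tildeA := by
  obtain ⟨e', he'⟩ := h.exists_equiv_of_selfDual e
  have : NeZero n := ⟨hn⟩
  have : IsSimpleModule K[G] ρ.asModule :=
    have := h.irreducible
    inferInstance
  let d : (Fin n ⊕ Fin n → W) ≃ₗ[K] (Fin n ⊕ Fin n → ρ.asModule) :=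
    LinearEquiv.piCongrRight fun _ => ρ.asModuleEquiv.symm
  refine isSimpleRing_commutant h.groupAction (e'.trans d) (fun a m => funext fun i => ?_)
    h.tildeA fun f => h.mem_tildeA_iff_groupAction
  change ρ.asModuleEquiv.symm (e' (h.groupAction a m) i) = a • ρ.asModuleEquiv.symm (e' m i)
  rw [he', LinearEquiv.symm_apply_eq, Representation.asModuleEquiv_map_smul,
    LinearEquiv.apply_symm_apply]

/-- As $n\ne0$, an element killing $\widetilde V$ kills $\rho$, hence also $\rho^*\cong\rho$; so it
is zero in the factor. -/
theorem tildeAction_injective {n : ℕ} (hn : n ≠ 0) (hd : Nonempty (ρ.Equiv ρ.dual))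
    (e : π.Equiv (repPow ρ n)) :
    Function.Injective (tildeAction (factorInvolution ρ) h.action) := by
  obtain ⟨e', he'⟩ := h.exists_equiv_of_selfDual e
  obtain ⟨d⟩ := hd
  have : NeZero n := ⟨hn⟩
  rw [injective_iff_map_eq_zero]
  intro a ha
  obtain ⟨x, rfl⟩ := Ideal.Quotient.mk_surjective a
  have hx : ρ.asAlgebraHom x = 0 := LinearMap.ext fun w => by
    have := he' x (e'.symm fun _ => w) (Sum.inl 0)
    rw [e'.apply_symm_apply] at this
    rw [← this]
    change e' (tildeAction _ _ (Ideal.Quotient.mk _ x) _) _ = _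
    rw [ha, LinearMap.zero_apply, map_zero]
    rfl
  refine Ideal.Quotient.eq_zero_iff_mem.2 ((mem_factorIdeal ρ x).2 ⟨hx, LinearMap.ext fun η => ?_⟩)
  obtain ⟨w, rfl⟩ := d.toLinearEquiv.surjective η
  change ρ.dual.asAlgebraHom x (d w) = 0
  rw [← equiv_asAlgebraHom, hx, LinearMap.zero_apply, map_zero]

/-- If `ρ` is self-dual, every central element of `Ã` comes from the centre of the factor of the
group algebra. -/
theorem exists_centerAction_eq [Finite G] [CharZero K] {n : ℕ} (hn : n ≠ 0)
    (hd : Nonempty (ρ.Equiv ρ.dual)) (e : π.Equiv (repPow ρ n)) {b : h.tildeA}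
    (hb : ∀ x, x * b = b * x) : ∃ z, h.centerAction z = b := by
  have := isSemisimpleRing_groupAlgebra (K := K) (G := G)
  -- $b$ commutes with the whole commutant of $K[G]$, so it is the action of some $a$; since $b$
  -- also lies in that commutant, faithfulness makes the class of $a$ central.
  obtain ⟨a, ha⟩ := exists_of_mem_double_commutant h.groupAction b.1 fun f hf =>
    (congrArg Subtype.val (hb ⟨f, h.mem_tildeA_iff_groupAction.2 hf⟩)).symm
  refine ⟨⟨Ideal.Quotient.mk _ a, Subalgebra.mem_center_iff.2 fun x =>
    h.tildeAction_injective hn hd e ?_⟩, Subtype.ext ha⟩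
  have ha' : tildeAction (factorInvolution ρ) h.action (Ideal.Quotient.mk _ a) = b.1 := ha
  rw [map_mul, map_mul, ha', h.tildeAction_comm]

end IsotypicSetup

set_option maxHeartbeats 4000000 in
theorem mainTheorem9 {K : Type*} [Field K] [CharZero K] {G : Type*} [Group G] [Finite G]
    {V : Type*} [AddCommGroup V] [Module K V] [FiniteDimensional K V]
    {W : Type*} [AddCommGroup W] [Module K W]
    (π : Representation K G V) (ρ : Representation K G W) (h : IsotypicSetup π ρ) :
    (¬ (h.tildeSigma.IsOrthogonal ∧ algDegree h.tildeA = 4) → h.generated = ⊤) ∧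
    (h.tildeSigma.IsOrthogonal ∧ algDegree h.tildeA = 4 →
      ∃ e : h.generated ≃ₗ⁅K⁆ slTwo K (Subalgebra.center K (GroupAlgFactor ρ)),
        ∀ (z : Subalgebra.center K (GroupAlgFactor ρ)) (x : h.generated),
          ∃ y : h.generated,
            h.toEnd y = tildeAction (factorInvolution ρ) h.action z * h.toEnd x ∧
            ∀ i j, (e y).1 i j = z * (e x).1 i j) := by
  obtain ⟨u, v, p, hu, hv⟩ := h.exists_hyperbolicPair
  have hS : ∀ x : h.s, x ∈ {x : h.s | EndHasDegree 2 (h.toEnd x) ∨ EndHasDegree (-2) (h.toEnd x)} ↔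
      (∃ b, p.coreInvolution b = b ∧ h.tildeSigma.derivedSkewCoe x = b * u) ∨
        ∃ b, p.coreInvolution b = b ∧ h.tildeSigma.derivedSkewCoe x = b * v := fun x => by
    rw [← p.upper_iff (h.tildeSigma.skew_derivedSkewCoe x),
      ← p.lower_iff (h.tildeSigma.skew_derivedSkewCoe x), ← hu, ← hv]
    rfl
  by_cases hd : Nonempty (ρ.Equiv ρ.dual)
  · obtain ⟨n, he, -⟩ := h.isotypic
    obtain ⟨e⟩ := he hd
    -- For $n=0$ the algebra is the zero ring: generation is trivial, and the exceptional case
    -- cannot occur because it includes simplicity.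
    by_cases hn : n = 0
    · subst hn
      have hV : Subsingleton V := e.toLinearEquiv.toEquiv.subsingleton
      have hR : Subsingleton h.tildeA := ⟨fun x y => Subtype.ext <| LinearMap.ext fun w =>
        tilde_ext (Subsingleton.elim _ _) (LinearMap.ext fun v => by
          rw [Subsingleton.elim v 0, map_zero, map_zero])⟩
      refine ⟨fun _ => ?_, fun ho => ?_⟩
      · refine p.lieSpan_eq_top hS fun x y => ?_
        rw [show x * y - y * x = 0 from Subtype.ext (Subsingleton.elim _ _)]
        exact zero_mem _
      · have := ho.1.1
        exact absurd hR (not_subsingleton _)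
    · have := h.isSimpleRing_tildeA hn e
      have := p.isSimpleRing_core
      refine ⟨fun ho => p.lieSpan_eq_top hS
        (p.coreInvolution.commutator_mem_symMul_of_simple fun hc =>
          ho (p.isOrthogonal_of_sym_eq_center hc.1 hc.2)), fun ho => ?_⟩
      -- In the exceptional case the symmetric elements of the centralizer are exactly the image of
      -- $F$.
      have hH : ∀ b : p.core, p.coreInvolution b = b ↔ ∃ z, h.centerAction z = b := fun b => by
        constructor
        · intro hb
          exact h.exists_centerAction_eq hn hd e
            (Subring.mem_center_iff.1 (p.mem_center_of_isOrthogonal ho.1 ho.2 hb))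
        · rintro ⟨z, hz⟩
          refine Subtype.ext ((p.coe_coreInvolution b).trans (ho.1.2.1 _ ?_))
          rw [← hz]
          exact Subring.mem_center_iff.2 fun x => (h.centerAction_comm z x).symm
      exact (p.exists_equiv_slTwo hS h.centerAction
        (fun z z' hz => Subtype.ext (h.tildeAction_injective hn hd e (congrArg Subtype.val hz)))
        h.centerAction_comm hH).imp fun f hf z x =>
          (hf z x).imp fun y hy => ⟨congrArg Subtype.val hy.1, hy.2⟩
  -- For $\rho\not\cong\rho^*$ the central skew square root of $1$ gives generation unconditionally.
  -- An orthogonal involution would fix it, forcing $c=-c$ and hence $1=0$.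
  · obtain ⟨z, hz, hzz, hzσ⟩ := exists_central_skew h.irreducible hd
    let c : h.tildeA := ⟨_, h.tildeAction_mem hz⟩
    have hc : ∀ x, c * x = x * c := fun x => Subtype.ext (h.tildeAction_comm z x)
    have hcc : c * c = 1 := Subtype.ext <| by
      change tildeAction _ _ z * tildeAction _ _ z = 1
      rw [← map_mul, hzz, map_one]
    have hcσ : h.tildeSigma c = -c := Subtype.ext <| by
      change tildeAdjoint (tildeAction _ _ z) = -tildeAction _ _ z
      rw [tildeAdjoint_action, hzσ, map_neg]
    refine ⟨fun _ => p.lieSpan_eq_top hS ?_, fun ho => ?_⟩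
    · exact p.coreInvolution.commutator_mem_symMul_of_central
        (e := ⟨c, p.mem_core.2 ⟨(hc u).symm, (hc v).symm⟩⟩) (fun x => Subtype.ext (hc x))
        (Subtype.ext hcc) (Subtype.ext hcσ)
    · have := ho.1.1
      have h1 : c = -c :=
        (ho.1.2.1 c (Subring.mem_center_iff.2 fun x => (hc x).symm)).symm.trans hcσ
      have h2 : (2 : K) • c = 0 := by rw [two_smul]; nth_rewrite 2 [h1]; exact add_neg_cancel c
      have h3 : c = 0 := (smul_eq_zero.1 h2).resolve_left two_ne_zero
      rw [h3, mul_zero] at hcc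
      exact absurd hcc zero_ne_one
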